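/- **Conventions.** A graph $G=(V,H,E,\epsilon)$ has finite sets $V$ of vertices and $H$ of half-edges, a partition $E$ of $H$ into unordered pairs (the edges), and a map $\epsilon:H\to V$ (incidence); loops and multiple edges are allowed. A directed version $D$ of $G$ chooses a tail and a head for each edge. $G$ is 4-regular if every vertex is incident to exactly four half-edges; $c(G)$ is the number of connected components. A closed walk is a sequence $((h_1,h_2),(h_3,h_4),\dots,(h_{n-1},h_n))$, up to cyclic shifts, where the half-edges of each pair are incident to a common vertex, and $\{h_2,h_3\},\{h_4,h_5\},\dots,\{h_n,h_1\}$ are edges; it is an oriented circuit if it is nonempty and no half-edge appears twice in it. A circuit is an oriented circuit without its orientation. A circuit partition of $G$ is a set $P$ of circuits such that each half-edge occurs in exactly one of them. For a maximal forest $T$ of $G$, a strictly fundamental cycle basis of $G$ (with respect to $T$) consists of one orientation of the fundamental circuit of each edge $e\notin T$, i.e. of the circuit whose only edge outside $T$ is $e$. Let $F$ be a 4-regular graph. A transition at a vertex $v$ is a partition into two pairs (single transitions) of the four half-edges incident to $v$; $\mathfrak T(F)$ is the set of all transitions of $F$, and $\Omega$ is its partition into the classes $\omega_v$ of transitions at $v$,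 $v\in V(F)$. A transversal of $\Omega$ has exactly one element in each class; a subtransversal is a subset of a transversal. For a circuit partition $P$, $\tau(P)$ is the transversal of those transitions whose single transitions occur in circuits of $P$; every transversal is $\tau(P)$ for exactly one $P$. A multimatroid $(U,\Omega,r)$ consists of a partition $\Omega$ of a finite set $U$ and a function $r$ from the subtransversals of $\Omega$ to $\mathbb N$ such that, for each subtransversal $S$, $r$ restricted to the subsets of $S$ is the rank function of a matroid on $S$, and $\max\{r(S\cup\{x\}),r(S\cup\{y\})\}>r(S)$ whenever $x\neq y$ lie in a class of $\Omega$ disjoint from $S$. It is a 3-matroid if each class of $\Omega$ has three elements. A strict representation of it over $\mathbb Q$ is a matrix over $\mathbb Q$ with columns indexed by $U$ such that the column matroid $M$ has a rank function extending $r$ and the rank of $M$ is $\max_S r(S)$. The Eulerian 3-matroid $Q(F)$ is the 3-matroid $(\mathfrak T(F),\Omega,r)$ with $r(\tau(P))=|V(F)|-(|P|-c(F))$ for each circuit partition $P$ of $F$. A matrix with columns indexed by $\mathfrak T(F)$ is totally transversally unimodular if, for each transversal $T$, its submatrix formed by the columns in $T$ is totally unimodular. For a directed version $D$ of $F$ and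 a finite set $B$ of closed walks of $F$, $\mathrm{CM}(F,B,D)$ is the $B\times E(F)$-matrix whose $(W,e)$-entry is the number of times that $W$ traverses $e$ along the direction of $D$ minus the number of times that it does so against it. A transitional orientation $\mathbf o$ of $F$ chooses one single transition $\mathbf o(t)\in t$ for each $t\in\mathfrak T(F)$. The $E(F)\times\mathfrak T(F)$-matrix $M_{D,\mathbf o}$ has $(e,t)$-entry $1$ if $e\cap\mathbf o(t)=\{h\}$ with $h$ the tail of $e$ in $D$, $-1$ if $e\cap\mathbf o(t)=\{h\}$ with $h$ the head of $e$ in $D$, and $0$ otherwise. **Theorem.** Let $F$ be a 4-regular graph. Then there is exactly one Eulerian 3-matroid $Q(F)$ of $F$, and $Q(F)$ has a strict, totally transversally unimodular representation over $\mathbb Q$. More precisely, let $E\subseteq E(F)$ contain exactly one edge of each connected component of $F$, let $B$ be a strictly fundamental cycle basis of $F-E$, let $D$ be a directed version of $F$, and let $\mathbf o$ be a transitional orientation of $F$. Such $E,B,D,\mathbf o$ exist, and for all of them the matrix $\mathrm{CM}(F,B,D)\cdot M_{D,\mathbf o}$ is a strict representation of $Q(F)$ and is totally transversally unimodular. -/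

import Mathlib

/-- A graph with vertex set `V` (loops and multiple edges allowed), given by half-edges.
Its edge set is a set of pairwise disjoint two-element sets; its set of half-edges is the union
of the edges, so that the edges form a partition of the half-edges into unordered pairs.
`inc` sends a half-edge to the vertex it is incident to. -/
structure HalfEdgeGraph (V H : Type*) where
  inc : H → V
  edges : Finset (Finset H)
  card_edge : ∀ e ∈ edges, e.card = 2
  disjoint_edges : ∀ e ∈ edges, ∀ e' ∈ edges, e ≠ e' → Disjoint e e'

/-- `T` contains precisely one element of every class of `Ω`. -/
def IsTransversal {U : Type*} (Ω : Set (Set U)) (T : Set U) : Prop :=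
  ∀ ω ∈ Ω, ∃! x, x ∈ T ∧ x ∈ ω

/-- The subsets of transversals. -/
def Subtransversal {U : Type*} (Ω : Set (Set U)) : Type _ :=
  {S : Set U // ∃ T, IsTransversal Ω T ∧ S ⊆ T}

/-- A multimatroid `(U, Ω, r)`, for a given family `Ω` of subsets of the finite set `U`. -/
structure Multimatroid {U : Type*} (Ω : Set (Set U)) where
  finite : Finite U
  isPartition : Setoid.IsPartition Ω
  /-- The rank function, defined on subtransversals only. -/
  r : Subtransversal Ω → ℕ
  /-- The restriction of `r` to the subsets of `S` is the rank function of a matroid on `S`. -/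
  matroid : ∀ S : Subtransversal Ω, ∃ M : Matroid U, M.E = S.1 ∧
    ∀ R : Subtransversal Ω, R.1 ⊆ S.1 → M.eRk R.1 = (r R : ℕ∞)
  lt_max : ∀ S : Subtransversal Ω, ∀ ω ∈ Ω, Disjoint ω S.1 → ∀ x ∈ ω, ∀ y ∈ ω, x ≠ y →
    ∀ Sx Sy : Subtransversal Ω, Sx.1 = S.1 ∪ {x} → Sy.1 = S.1 ∪ {y} →
      r S < max (r Sx) (r Sy)

namespace Multimatroid

variable {U : Type*} {Ω : Set (Set U)}

/-- A `k`-matroid: every skew class has exactly `k` elements. -/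
def IsKMatroid (_Z : Multimatroid Ω) (k : ℕ) : Prop :=
  ∀ ω ∈ Ω, ω.ncard = k

/-- `M` is a matroid on `U` whose rank function restricts to the one of `Z`. -/
def ShelteredBy (Z : Multimatroid Ω) (M : Matroid U) : Prop :=
  M.E = Set.univ ∧ ∀ S : Subtransversal Ω, M.eRk S.1 = (Z.r S : ℕ∞)

/-- `M` shelters `Z`, and its rank is the maximum of the rank function of `Z`. -/
def StrictlyShelteredBy (Z : Multimatroid Ω) (M : Matroid U) : Prop :=
  Z.ShelteredBy M ∧ IsGreatest (Set.range fun S : Subtransversal Ω => (Z.r S : ℕ∞)) M.eRank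

end Multimatroid

/-- The matrix `A` represents the matroid `M`: the ground set of `M` is the set of columns of `A`,
and independence is linear independence of columns. -/
def RepresentsMatroid {X U K : Type*} [Field K] (A : Matrix X U K) (M : Matroid U) : Prop :=
  M.E = Set.univ ∧ ∀ I : Set U, M.Indep I ↔ LinearIndepOn K A.col I

/-- The matrix `A` is a strict representation of the multimatroid `Z`. -/
def IsStrictRepresentation {X U K : Type*} [Field K] {Ω : Set (Set U)}
    (A : Matrix X U K) (Z : Multimatroid Ω) : Prop :=
  ∃ M : Matroid U, RepresentsMatroid A M ∧ Z.StrictlyShelteredBy M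

/-- For every transversal `T`, the submatrix formed by the columns in `T` is
totally unimodular. -/
def IsTotallyTransversallyUnimodular {X U K : Type*} [Field K] (Ω : Set (Set U))
    (A : Matrix X U K) : Prop :=
  ∀ T : Set U, IsTransversal Ω T →
    (A.submatrix id (Subtype.val : T → U)).IsTotallyUnimodular

namespace HalfEdgeGraph

variable {V H : Type*}

/-- Two vertices are adjacent (possibly equal) if some edge has half-edges at both. -/
def Adj (G : HalfEdgeGraph V H) (u v : V) : Prop :=
  ∃ e ∈ G.edges, ∃ h ∈ e, ∃ h' ∈ e, G.inc h = u ∧ G.inc h' = v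

/-- Connected components: the classes of the equivalence relation generated by adjacency. -/
def Component (G : HalfEdgeGraph V H) : Type _ := Quot G.Adj

/-- The number of connected components. -/
noncomputable def numComponents (G : HalfEdgeGraph V H) : ℕ := Nat.card G.Component

/-- `E` is a set of edges of `G` containing exactly one edge of each connected component. -/
def OneEdgePerComponent (G : HalfEdgeGraph V H) (E : Finset (Finset H)) : Prop :=
  E ⊆ G.edges ∧ ∀ c : G.Component, ∃! e, e ∈ E ∧ ∃ h ∈ e, Quot.mk G.Adj (G.inc h) = c

variable [DecidableEq H]

/-- The graph `G - E`. -/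
def deleteEdges (G : HalfEdgeGraph V H) (E : Finset (Finset H)) : HalfEdgeGraph V H where
  inc := G.inc
  edges := G.edges \ E
  card_edge e he := G.card_edge e (Finset.mem_sdiff.1 he).1
  disjoint_edges e he e' he' := G.disjoint_edges e (Finset.mem_sdiff.1 he).1 e'
    (Finset.mem_sdiff.1 he').1

/-- The set of half-edges of `G`. -/
def halfEdges (G : HalfEdgeGraph V H) : Finset H := G.edges.biUnion id

/-- The set of half-edges incident to `v`. -/
def star [DecidableEq V] (G : HalfEdgeGraph V H) (v : V) : Finset H :=
  G.halfEdges.filter fun h => G.inc h = v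

/-- Every vertex is incident to exactly `k` half-edges. -/
def IsRegular [DecidableEq V] (G : HalfEdgeGraph V H) (k : ℕ) : Prop :=
  ∀ v, (G.star v).card = k

/-! ### Walks and circuits -/

/-- A closed walk: a sequence of directed single transitions `(h₁, h₂), (h₃, h₄), …`, up to cyclic
shifts, where `h₁, h₂` are incident to a common vertex, as are `h₃, h₄`, etc., and the second
half-edge of each pair and the first half-edge of the (cyclically) next pair form an edge. -/
def IsClosedWalk (G : HalfEdgeGraph V H) (W : Cycle (H × H)) : Prop :=
  (∀ p ∈ W, G.inc p.1 = G.inc p.2) ∧ W.Chain fun p q => {p.2, q.1} ∈ G.edges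

/-- An oriented circuit: a nonempty closed walk in which each half-edge appears at most once. -/
def IsOrientedCircuit (G : HalfEdgeGraph V H) (W : Cycle (H × H)) : Prop :=
  G.IsClosedWalk W ∧ W ≠ Cycle.nil ∧
    (W.toMultiset.map Prod.fst + W.toMultiset.map Prod.snd).Nodup

/-- The walk `W` traverses the edge `e`. -/
def Traverses (W : Cycle (H × H)) (e : Finset H) : Prop :=
  ∀ h ∈ e, ∃ p ∈ W, h = p.1 ∨ h = p.2

/-- The (unoriented) circuit underlying an oriented circuit, as a set of single transitions. -/
def toCircuit (W : Cycle (H × H)) : Finset (Finset H) :=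
  (W.toMultiset.map fun p => ({p.1, p.2} : Finset H)).toFinset

/-- A circuit, as a set of single transitions. -/
def IsCircuit (G : HalfEdgeGraph V H) (C : Finset (Finset H)) : Prop :=
  ∃ W, G.IsOrientedCircuit W ∧ C = toCircuit W

/-- A circuit partition: a set of circuits such that every half-edge occurs in exactly one. -/
def IsCircuitPartition (G : HalfEdgeGraph V H) (P : Finset (Finset (Finset H))) : Prop :=
  (∀ C ∈ P, G.IsCircuit C) ∧ ∀ h ∈ G.halfEdges, ∃! C, C ∈ P ∧ ∃ s ∈ C, h ∈ s

/-! ### Strictly fundamental cycle bases -/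

/-- `T` is (the edge set of) a forest of `G`: no circuit of `G` has all its edges in `T`. -/
def IsForest (G : HalfEdgeGraph V H) (T : Finset (Finset H)) : Prop :=
  T ⊆ G.edges ∧ ¬ ∃ W, G.IsOrientedCircuit W ∧ ∀ e ∈ G.edges, Traverses W e → e ∈ T

/-- `T` is (the edge set of) a maximal forest of `G`. -/
def IsMaximalForest (G : HalfEdgeGraph V H) (T : Finset (Finset H)) : Prop :=
  Maximal G.IsForest T

/-- `W` is one of the orientations of the fundamental circuit of `e` with respect to `T`: an
oriented circuit such that the only edge that it traverses outside `T` is `e`. -/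
def IsFundamentalCircuit (G : HalfEdgeGraph V H) (T : Finset (Finset H)) (e : Finset H)
    (W : Cycle (H × H)) : Prop :=
  G.IsOrientedCircuit W ∧ ∀ e' ∈ G.edges \ T, Traverses W e' ↔ e' = e

/-- `B` is a strictly fundamental cycle basis of `G`: for some maximal forest `T`, it consists of
precisely one orientation of the fundamental circuit of each edge outside `T`. -/
def IsStrictlyFundamentalCycleBasis (G : HalfEdgeGraph V H) (B : Finset (Cycle (H × H))) : Prop :=
  ∃ T, G.IsMaximalForest T ∧
    (∀ W ∈ B, ∃ e ∈ G.edges \ T, G.IsFundamentalCircuit T e W) ∧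
    ∀ e ∈ G.edges \ T, ∃! W, W ∈ B ∧ G.IsFundamentalCircuit T e W

/-- A directed version of `G`: each edge is given a tail and a head. -/
structure DirectedVersion (G : HalfEdgeGraph V H) where
  tail : G.edges → H
  head : G.edges → H
  tail_head : ∀ e, {tail e, head e} = e.1

/-- The incidence vector of a closed walk `W`: the number of times `W` traverses `e` along the
direction of `D` (that is, leaves a vertex through the tail of `e`), minus the number of times
`W` traverses `e` against it (leaves a vertex through the head of `e`). -/
def incidenceVector {G : HalfEdgeGraph V H} (D : G.DirectedVersion) (W : Cycle (H × H)) :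
    G.edges → ℤ := fun e =>
  ((W.toMultiset.map Prod.snd).count (D.tail e) : ℤ) -
    ((W.toMultiset.map Prod.snd).count (D.head e) : ℤ)

/-- The cycle matrix `CM(G, B, D)`: the row indexed by `W ∈ B` is the incidence vector of `W`. -/
def cycleMatrix (G : HalfEdgeGraph V H) (B : Finset (Cycle (H × H))) (D : G.DirectedVersion) :
    Matrix B G.edges ℤ :=
  Matrix.of fun W => incidenceVector D W.1

/-! ### Transitions and the Eulerian 3-matroid -/

variable [DecidableEq V]

/-- `t` is a transition at `v`: a partition into pairs of the half-edges incident to `v`. -/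
def IsTransitionAt (G : HalfEdgeGraph V H) (v : V) (t : Finset (Finset H)) : Prop :=
  (∀ s ∈ t, s.card = 2) ∧ (∀ s ∈ t, ∀ s' ∈ t, s ≠ s' → Disjoint s s') ∧ t.biUnion id = G.star v

/-- The transitions of `G`. -/
abbrev Transition (G : HalfEdgeGraph V H) : Type _ :=
  {t : Finset (Finset H) // ∃ v, G.IsTransitionAt v t}

/-- The partition of the transitions of `G` according to the vertex where they reside. -/
def skewClasses (G : HalfEdgeGraph V H) : Set (Set G.Transition) :=
  Set.range fun v => {t : G.Transition | G.IsTransitionAt v t.1}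

/-- The set of transitions `τ(P)` of a circuit partition `P`: those whose single transitions
belong to circuits of `P`. -/
def tau (G : HalfEdgeGraph V H) (P : Finset (Finset (Finset H))) : Set G.Transition :=
  {t | ∀ s ∈ t.1, ∃ C ∈ P, s ∈ C}

/-- `Q` is the Eulerian 3-matroid of the 4-regular graph `F`: the 3-matroid on the transitions of
`F`, with the transitions at each vertex as skew classes, such that a transversal `T` has rank
`|V(F)| - (|P| - c(F))`, where `P` is the circuit partition with `τ(P) = T`. -/
def IsEulerian3Matroid [Fintype V] (F : HalfEdgeGraph V H) (Q : Multimatroid F.skewClasses) :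
    Prop :=
  Q.IsKMatroid 3 ∧
    ∀ T : Subtransversal F.skewClasses, IsTransversal F.skewClasses T.1 →
      ∀ P, F.IsCircuitPartition P → F.tau P = T.1 →
        (Q.r T : ℤ) = (Fintype.card V : ℤ) - ((P.card : ℤ) - (F.numComponents : ℤ))

/-- A transitional orientation: a choice of one of the two single transitions of each
transition. -/
abbrev TransitionalOrientation (F : HalfEdgeGraph V H) : Type _ :=
  {o : F.Transition → Finset H // ∀ t, o t ∈ t.1}

/-- The edge-transition incidence matrix `M_{D,o}`. -/
def edgeTransitionMatrix {F : HalfEdgeGraph V H} (D : F.DirectedVersion)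
    (o : F.TransitionalOrientation) : Matrix F.edges F.Transition ℚ :=
  Matrix.of fun e t =>
    if e.1 ∩ o.1 t = {D.tail e} then 1 else if e.1 ∩ o.1 t = {D.head e} then -1 else 0

/-- The matrix `CM(F, B, D) · M_{D,o}`. -/
def representationMatrix (F : HalfEdgeGraph V H) (B : Finset (Cycle (H × H)))
    (D : F.DirectedVersion) (o : F.TransitionalOrientation) : Matrix B F.Transition ℚ :=
  (F.cycleMatrix B D).map (Int.cast : ℤ → ℚ) * edgeTransitionMatrix D o

end HalfEdgeGraph

/-! ### Linear algebra -/

/-! A rational flow on `F` is a function on half-edges that changes sign across each edge and sums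
to zero at each vertex. The circuits in `B` give integral flows forming a basis of the space of
flows that vanish on `E`; the coordinates of a flow are its values at one half-edge of each
non-forest edge (`IsFlowBasis`). The entry of the representation matrix at `(W, t)` is the flow of
`W` through the single transition `o t` (`representationMatrix_apply`). So a combination of rows
vanishes on the columns in `S` exactly if the corresponding flow splits along `S`, that is, sums to
zero over every single transition of `S`. The rank of `S` is therefore `|V| - dim (splitFlows E S)`,
since 4-regularity gives `dim (flows E) = |V|` (`finrank_flows`).

Let `T = τ(P)`. Fix a flow with values `±1` that orients the circuits of `P` (`exists_sign`). A flow
splitting along `T` is this flow times one constant for each circuit. Vanishing on `E` kills the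
constants of `c(F)` different circuits, so `|P| - c(F)` remain, which is the rank formula. The axiom
about two elements of a class needs a flow that splits along `S` but violates one of two given
transitions at a vertex; it is built from two of the `±1`-flows belonging to the three transitions
there. A 3-matroid is unique given its transversal ranks, because every subtransversal extends to a
transversal with the rank growing by one at each new element.

For unimodularity, let `N` be a nonsingular square submatrix with columns in a transversal. It
suffices that its inverse is integral, i.e. that `c` is integral whenever `c N` is
(`coeff_integral`). The half-edges where the flow of `c` is not integral form a set that meets no
edge and no side of a split vertex in a single half-edge. Such a set carries a nonzero flow
(`exists_ne_zero_fiber_sum_eq_zero`, which also underlies `exists_sign`), and the coordinates of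
that flow lie in the left kernel of `N`, a contradiction. -/

theorem Finset.two_mul_card_image_le_card {H Z : Type*} [DecidableEq Z] {s : Finset H} (k : H → Z)
    (hk : ∀ h ∈ s, ∃ h' ∈ s, h' ≠ h ∧ k h' = k h) : 2 * (s.image k).card ≤ s.card := by
  refine Finset.mul_card_image_le_card s 2 fun z hz => ?_
  obtain ⟨h, hh, rfl⟩ := Finset.mem_image.1 hz
  obtain ⟨h', hh', hne, he⟩ := hk h hh
  refine Finset.one_lt_card.2 ⟨h', ?_, h, ?_, hne⟩ <;> simp [*]

/-- If no fibre of `p` or `q` meets `s` in a single element, some nonzero function supported on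
`s` sums to zero over all fibres of both maps. -/
theorem exists_ne_zero_fiber_sum_eq_zero {H X Y : Type*} [DecidableEq H] [DecidableEq X]
    [DecidableEq Y] (s : Finset H) (hs : s.Nonempty) (p : H → X) (q : H → Y)
    (hp : ∀ h ∈ s, ∃ h' ∈ s, h' ≠ h ∧ p h' = p h)
    (hq : ∀ h ∈ s, ∃ h' ∈ s, h' ≠ h ∧ q h' = q h) :
    ∃ f : H → ℚ, f ≠ 0 ∧ (∀ h, h ∉ s → f h = 0) ∧
      (∀ x, ∑ h ∈ s with p h = x, f h = 0) ∧ ∀ y, ∑ h ∈ s with q h = y, f h = 0 := by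
  have hX := Finset.two_mul_card_image_le_card p hp
  have hY := Finset.two_mul_card_image_le_card q hq
  let ext : (s → ℚ) → H → ℚ := fun f h => if hh : h ∈ s then f ⟨h, hh⟩ else 0
  have ext_mem : ∀ f (h : s), ext f h = f h := fun f h => by simp [ext]
  let L : (s → ℚ) →ₗ[ℚ] (s.image p → ℚ) × (s.image q → ℚ) :=
    { toFun := fun f => (fun x => ∑ h ∈ s with p h = x, ext f h,
        fun y => ∑ h ∈ s with q h = y, ext f h)
      map_add' := fun f g => by
        have : ext (f + g) = ext f + ext g := by
          ext h; by_cases hh : h ∈ s <;> simp [ext, hh]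
        ext <;> simp [this, Finset.sum_add_distrib]
      map_smul' := fun c f => by
        have : ext (c • f) = c • ext f := by
          ext h; by_cases hh : h ∈ s <;> simp [ext, hh]
        ext <;> simp [this, Finset.mul_sum] }
  have sum1 : ∀ f, ∑ x, (L f).1 x = ∑ h ∈ s, ext f h := fun f => by
    change ∑ x : s.image p, ∑ h ∈ s with p h = x, ext f h = _
    rw [Finset.sum_coe_sort (s.image p) fun x => ∑ h ∈ s with p h = x, ext f h]
    exact Finset.sum_fiberwise_of_maps_to (fun h hh => Finset.mem_image_of_mem p hh) _
  have sum2 : ∀ f, ∑ x, (L f).2 x = ∑ h ∈ s, ext f h := fun f => by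
    change ∑ x : s.image q, ∑ h ∈ s with q h = x, ext f h = _
    rw [Finset.sum_coe_sort (s.image q) fun x => ∑ h ∈ s with q h = x, ext f h]
    exact Finset.sum_fiberwise_of_maps_to (fun h hh => Finset.mem_image_of_mem q hh) _
  -- There are at most `|s|` equations in `|s|` unknowns, so an injective `L` would be bijective.
  -- But the two families of fibre sums have the same total, so a pair with totals `1` and `0` is
  -- not attained.
  have hker : ¬ Function.Injective L := by
    intro hinj
    have hle := LinearMap.finrank_le_finrank_of_injective hinj
    have heq : Module.finrank ℚ (s → ℚ) =
        Module.finrank ℚ ((s.image p → ℚ) × (s.image q → ℚ)) := by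
      simp only [Module.finrank_prod, Module.finrank_fintype_fun_eq_card, Fintype.card_coe]
        at hle ⊢
      omega
    have hsurj := (LinearMap.injective_iff_surjective_of_finrank_eq_finrank heq).1 hinj
    obtain ⟨h₀, hh₀⟩ := hs
    obtain ⟨f, hf⟩ := hsurj (Pi.single ⟨p h₀, Finset.mem_image_of_mem p hh₀⟩ 1, 0)
    have h1 := sum1 f
    rw [← sum2 f, hf] at h1
    simp at h1
  rw [← LinearMap.ker_eq_bot, Submodule.eq_bot_iff] at hker
  push Not at hker
  obtain ⟨f, hf, hne⟩ := hker
  have hf : L f = 0 := hf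
  refine ⟨ext f, fun h0 => hne ?_, fun h hh => by simp [ext, hh], fun x => ?_, fun y => ?_⟩
  · ext h
    rw [← ext_mem f h, h0]; rfl
  · by_cases hx : x ∈ s.image p
    · exact congrFun (congrArg Prod.fst hf) ⟨x, hx⟩
    · rw [Finset.filter_eq_empty_iff.2, Finset.sum_empty]
      rintro h hh rfl
      exact hx (Finset.mem_image_of_mem p hh)
  · by_cases hy : y ∈ s.image q
    · exact congrFun (congrArg Prod.snd hf) ⟨y, hy⟩
    · rw [Finset.filter_eq_empty_iff.2, Finset.sum_empty]
      rintro h hh rfl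
      exact hy (Finset.mem_image_of_mem q hh)

/-- A nonzero determinant of an integral matrix is `±1` if the inverse matrix is integral. -/
theorem Matrix.det_mem_range_signType_cast {n : Type*} [Fintype n] [DecidableEq n]
    (N : Matrix n n ℤ) (N' : Matrix n n ℤ)
    (h : N'.map (Int.cast : ℤ → ℚ) * N.map (Int.cast : ℤ → ℚ) = 1) :
    (N.map (Int.cast : ℤ → ℚ)).det ∈ Set.range (SignType.cast : SignType → ℚ) := by
  have hdet : ∀ K : Matrix n n ℤ, (K.map (Int.cast : ℤ → ℚ)).det = ((K.det : ℤ) : ℚ) :=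
    fun K => ((Int.castRingHom ℚ).map_det K).symm
  have h1 := congrArg Matrix.det h
  rw [Matrix.det_mul, hdet, hdet, Matrix.det_one] at h1
  have h2 : N'.det * N.det = 1 := by exact_mod_cast h1
  rw [hdet]
  rcases Int.isUnit_iff.1 (IsUnit.of_mul_eq_one_right _ h2) with h3 | h3 <;> rw [h3]
  · exact ⟨1, by simp⟩
  · exact ⟨-1, by simp⟩

/-- The matroid on the index set of a finite family of vectors. -/
noncomputable def vectorMatroid (K : Type*) {U W : Type*} [Field K] [AddCommGroup W] [Module K W]
    [Finite U] (v : U → W) : Matroid U :=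
  (IndepMatroid.ofFinite (E := Set.univ) Set.finite_univ (LinearIndepOn K v)
    (linearIndepOn_empty K v) (fun _ _ hJ hIJ => hJ.mono hIJ)
    (fun I J hI hJ hIJ => by
      -- If augmentation failed, `v '' J` would lie in the span of `v '' I`, contrary to the sizes
      -- of `I` and `J`.
      by_contra! hcon
      have hsub : v '' J ⊆ Submodule.span K (v '' I) := by
        rintro _ ⟨e, he, rfl⟩
        by_cases heI : e ∈ I
        · exact Submodule.subset_span (Set.mem_image_of_mem v heI)
        · by_contra hn
          exact hcon e he heI (hI.insert hn)
      have card : ∀ {S : Set U}, LinearIndepOn K v S →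
          Module.finrank K (Submodule.span K (v '' S)) = S.ncard := fun {S} hS => by
        have := Fintype.ofFinite S
        rw [Set.image_eq_range, finrank_span_eq_card hS, Set.ncard_eq_toFinset_card',
          Set.toFinset_card]
      have := FiniteDimensional.span_of_finite K (I.toFinite.image v)
      have := Submodule.finrank_mono (Submodule.span_le.2 hsub)
      rw [card hI, card hJ] at this
      omega)
    fun _ _ => Set.subset_univ _).matroid

section vectorMatroid

variable {K U W : Type*} [Field K] [AddCommGroup W] [Module K W] [Finite U] (v : U → W)

theorem vectorMatroid_ground : (vectorMatroid K v).E = Set.univ := rfl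

theorem vectorMatroid_indep {I : Set U} :
    (vectorMatroid K v).Indep I ↔ LinearIndepOn K v I := by
  simp [vectorMatroid]

theorem vectorMatroid_eRk (S : Set U) :
    (vectorMatroid K v).eRk S = (Module.finrank K (Submodule.span K (v '' S)) : ℕ∞) := by
  obtain ⟨I, hI⟩ := (vectorMatroid K v).exists_isBasis S (by simp [vectorMatroid_ground])
  have hind := (vectorMatroid_indep v).1 hI.indep
  have hsub : v '' S ⊆ Submodule.span K (v '' I) := by
    rintro _ ⟨e, he, rfl⟩
    by_cases heI : e ∈ I
    · exact Submodule.subset_span (Set.mem_image_of_mem v heI)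
    · by_contra hn
      exact heI (hI.mem_of_insert_indep he ((vectorMatroid_indep v).2 (hind.insert hn)))
  have hspan : Submodule.span K (v '' S) = Submodule.span K (v '' I) :=
    le_antisymm (Submodule.span_le.2 hsub) (Submodule.span_mono (Set.image_mono hI.subset))
  have := Fintype.ofFinite I
  rw [← hI.encard_eq_eRk, hspan, Set.image_eq_range, finrank_span_eq_card hind,
    ← Set.toFinset_card, ← Set.encard_coe_eq_coe_finsetCard, Set.coe_toFinset]

end vectorMatroid

/-- The rank of a set of columns of a matrix, in terms of the row combinations vanishing there. -/
theorem finrank_span_col_add_finrank {B U : Type*} [Fintype B] (A : Matrix B U ℚ) (S : Set U)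
    (N : Submodule ℚ (B → ℚ)) (hN : ∀ c, c ∈ N ↔ ∀ t ∈ S, ∑ b, c b * A b t = 0) :
    Module.finrank ℚ (Submodule.span ℚ (A.col '' S)) + Module.finrank ℚ N = Fintype.card B := by
  classical
  -- A column `w` is read as the functional `c ↦ ∑ b, c b * w b`, so that `N` is the common kernel
  -- of the columns in `S`.
  let φ : (B → ℚ) ≃ₗ[ℚ] Module.Dual ℚ (B → ℚ) := (Pi.basisFun ℚ B).toDualEquiv
  have hφ : ∀ w c, φ w c = ∑ b, c b * w b := by
    intro w c
    have : φ w = ∑ b, w b • φ (Pi.basisFun ℚ B b) := by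
      conv_lhs => rw [← (Pi.basisFun ℚ B).sum_repr w]
      simp
    rw [this, LinearMap.sum_apply]
    refine Finset.sum_congr rfl fun b _ => ?_
    rw [LinearMap.smul_apply, smul_eq_mul, mul_comm]
    congr 1
    rw [Module.Basis.toDualEquiv_apply, Module.Basis.toDual_apply_right]
    simp
  have h := Subspace.finrank_add_finrank_dualCoannihilator_eq
    ((Submodule.span ℚ (A.col '' S)).map (φ : (B → ℚ) →ₗ[ℚ] Module.Dual ℚ (B → ℚ)))
  rw [LinearEquiv.finrank_map_eq, Module.finrank_fintype_fun_eq_card] at h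
  rw [← h]
  suffices hE : N = Submodule.dualCoannihilator _ by rw [hE]
  refine Submodule.ext fun c => ?_
  rw [hN, Submodule.mem_dualCoannihilator]
  constructor
  · rintro hc _ ⟨w, hw, rfl⟩
    induction hw using Submodule.span_induction with
    | mem w hw =>
      obtain ⟨t, ht, rfl⟩ := hw
      exact (hφ _ _).trans (hc t ht)
    | zero => simp
    | add w w' _ _ h1 h2 => rw [map_add, LinearMap.add_apply, h1, h2, add_zero]
    | smul k w _ h1 => rw [map_smul, LinearMap.smul_apply, h1, smul_zero]
  · intro hc t ht
    exact (hφ (A.col t) c).symm.trans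
      (hc _ ⟨_, Submodule.subset_span (Set.mem_image_of_mem _ ht), rfl⟩)

/-! ### Pairings -/

/-- A set of pairwise disjoint two-element sets. -/
structure IsPairing {H : Type*} (S : Finset (Finset H)) : Prop where
  card : ∀ s ∈ S, s.card = 2
  disjoint : ∀ s ∈ S, ∀ s' ∈ S, s ≠ s' → Disjoint s s'

section mate

variable {H : Type*} [DecidableEq H]

open Classical in
/-- The element that is paired with `h` in `S`, or `h` itself if there is no such element. -/
noncomputable def mate (S : Finset (Finset H)) (h : H) : H :=
  if hh : ∃ h', {h, h'} ∈ S then hh.choose else h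

variable {S : Finset (Finset H)} {h h' : H}

theorem IsPairing.eq_of_mem (hS : IsPairing S) {s s' : Finset H} (hs : s ∈ S) (hs' : s' ∈ S)
    (h1 : h ∈ s) (h2 : h ∈ s') : s = s' := by
  by_contra hne
  exact Finset.disjoint_left.1 (hS.disjoint s hs s' hs' hne) h1 h2

theorem IsPairing.ne_of_mem (hS : IsPairing S) (hh : {h, h'} ∈ S) : h ≠ h' := by
  rintro rfl
  have := hS.card _ hh
  simp at this

theorem IsPairing.mate_eq (hS : IsPairing S) (hh : {h, h'} ∈ S) : mate S h = h' := by
  have hex : ∃ h', {h, h'} ∈ S := ⟨h', hh⟩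
  have hm : mate S h = hex.choose := dif_pos hex
  rw [hm]
  have heq := hS.eq_of_mem hex.choose_spec hh (by simp) (by simp : h ∈ _)
  have hmem : hex.choose ∈ ({h, h'} : Finset H) := heq ▸ (by simp)
  have hne := hS.ne_of_mem hex.choose_spec
  simp only [Finset.mem_insert, Finset.mem_singleton] at hmem
  rcases hmem with h1 | h1
  · exact absurd h1.symm hne
  · exact h1

theorem IsPairing.mate_eq' (hS : IsPairing S) (hh : {h, h'} ∈ S) : mate S h' = h :=
  hS.mate_eq (Finset.pair_comm h h' ▸ hh)

theorem IsPairing.pair_mate_mem (hS : IsPairing S) (hh : h ∈ S.biUnion id) :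
    {h, mate S h} ∈ S := by
  obtain ⟨s, hs, hhs⟩ := Finset.mem_biUnion.1 hh
  obtain ⟨a, b, -, rfl⟩ := Finset.card_eq_two.1 (hS.card s hs)
  simp only [id, Finset.mem_insert, Finset.mem_singleton] at hhs
  rcases hhs with rfl | rfl
  · rwa [hS.mate_eq hs]
  · rwa [hS.mate_eq' hs, Finset.pair_comm]

theorem IsPairing.eq_pair_mate (hS : IsPairing S) {s : Finset H} (hs : s ∈ S) (hh : h ∈ s) :
    s = {h, mate S h} :=
  hS.eq_of_mem hs (hS.pair_mate_mem (Finset.mem_biUnion.2 ⟨s, hs, hh⟩)) hh (by simp)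

theorem mate_of_notMem (hh : h ∉ S.biUnion id) : mate S h = h := by
  refine dif_neg ?_
  rintro ⟨h', hh'⟩
  exact hh (Finset.mem_biUnion.2 ⟨_, hh', by simp⟩)

theorem IsPairing.mate_mate (hS : IsPairing S) (h : H) : mate S (mate S h) = h := by
  by_cases hh : h ∈ S.biUnion id
  · exact hS.mate_eq' (hS.pair_mate_mem hh)
  · rw [mate_of_notMem hh, mate_of_notMem hh]

theorem IsPairing.mate_ne (hS : IsPairing S) (hh : h ∈ S.biUnion id) : mate S h ≠ h :=
  (hS.ne_of_mem (hS.pair_mate_mem hh)).symm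

theorem IsPairing.mate_mem (hS : IsPairing S) (hh : h ∈ S.biUnion id) :
    mate S h ∈ S.biUnion id :=
  Finset.mem_biUnion.2 ⟨_, hS.pair_mate_mem hh, by simp⟩

theorem IsPairing.mate_mem_iff (hS : IsPairing S) :
    mate S h ∈ S.biUnion id ↔ h ∈ S.biUnion id :=
  ⟨fun hh => by simpa [hS.mate_mate] using hS.mate_mem hh, hS.mate_mem⟩

theorem IsPairing.mate_injective (hS : IsPairing S) : Function.Injective (mate S) :=
  (Function.LeftInverse.injective (g := mate S) hS.mate_mate)

theorem IsPairing.pair_eq_iff (hS : IsPairing S) (hh : h ∈ S.biUnion id) :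
    ({h', mate S h'} : Finset H) = {h, mate S h} ↔ h' = h ∨ h' = mate S h := by
  constructor
  · intro he
    have : h' ∈ ({h, mate S h} : Finset H) := he ▸ (by simp)
    simpa using this
  · rintro (rfl | rfl)
    · rfl
    · rw [hS.mate_mate, Finset.pair_comm]

/-- Since `Z` is closed under `mate S`, the fibre over the pair of a half-edge `h ∈ Z` is all of
`{h, mate S h}`, and a vanishing fibre sum is antisymmetry. -/
theorem IsPairing.apply_mate_eq_neg (hS : IsPairing S) {Z : Finset H} (hZ : Z ⊆ S.biUnion id)
    (hm : ∀ h ∈ Z, mate S h ∈ Z) {f : H → ℚ} (h0 : ∀ h, h ∉ Z → f h = 0)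
    (hsum : ∀ x, ∑ h ∈ Z with ({h, mate S h} : Finset H) = x, f h = 0) (h : H) :
    f (mate S h) = - f h := by
  by_cases hh : h ∈ Z
  · have hfil : {h' ∈ Z | ({h', mate S h'} : Finset H) = {h, mate S h}} = {h, mate S h} := by
      ext h'
      rw [Finset.mem_filter, hS.pair_eq_iff (hZ hh), Finset.mem_insert, Finset.mem_singleton]
      refine ⟨fun a => a.2, fun a => ⟨?_, a⟩⟩
      rcases a with rfl | rfl
      · exact hh
      · exact hm h hh
    have := hsum {h, mate S h}
    rw [hfil, Finset.sum_pair (hS.mate_ne (hZ hh)).symm] at this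
    linarith
  · have hh' : mate S h ∉ Z := fun hm' => hh (by simpa [hS.mate_mate] using hm _ hm')
    rw [h0 h hh, h0 _ hh', neg_zero]

/-- Two pairings of the same set have a common `±1`-valued antisymmetric function. -/
theorem exists_sign [Finite H] {S₁ S₂ : Finset (Finset H)} (h₁ : IsPairing S₁)
    (h₂ : IsPairing S₂) (hU : S₁.biUnion id = S₂.biUnion id) :
    ∃ g : H → ℚ, (∀ h ∈ S₁.biUnion id, g h = 1 ∨ g h = -1) ∧
      (∀ h, g (mate S₁ h) = - g h) ∧ ∀ h, g (mate S₂ h) = - g h := by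
  classical
  have := Fintype.ofFinite H
  let F : (H → ℚ) → Prop := fun f => (∀ h, f (mate S₁ h) = - f h) ∧ ∀ h, f (mate S₂ h) = - f h
  let Z : (H → ℚ) → Finset H := fun f => (S₁.biUnion id).filter fun h => f h = 0
  -- Among the common antisymmetric functions, take one with the fewest zeros. Its zero set is
  -- closed under both mates, so if it were nonempty, it would carry a correction `f'` that removes
  -- zeros and creates none. The signs of `f` then do.
  obtain ⟨f, hf, hmin⟩ : ∃ f, F f ∧ ∀ f', F f' → (Z f).card ≤ (Z f').card := by
    have hne : ∃ n f, F f ∧ (Z f).card = n := ⟨_, 0, ⟨by simp, by simp⟩, rfl⟩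
    obtain ⟨f, hf, hn⟩ := Nat.find_spec hne
    exact ⟨f, hf, fun f' hf' => hn ▸ Nat.find_min' hne ⟨f', hf', rfl⟩⟩
  have hZ : Z f = ∅ := by
    by_contra hne
    have mem1 : ∀ h ∈ Z f, mate S₁ h ∈ Z f := fun h hh => by
      simp only [Z, Finset.mem_filter] at hh ⊢
      exact ⟨h₁.mate_mem hh.1, by rw [hf.1, hh.2, neg_zero]⟩
    have mem2 : ∀ h ∈ Z f, mate S₂ h ∈ Z f := fun h hh => by
      simp only [Z, Finset.mem_filter] at hh ⊢
      refine ⟨?_, by rw [hf.2, hh.2, neg_zero]⟩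
      rw [hU] at hh ⊢
      exact h₂.mate_mem hh.1
    have memU : Z f ⊆ S₁.biUnion id := Finset.filter_subset _ _
    obtain ⟨f', hf'0, hf'Z, hf'1, hf'2⟩ := exists_ne_zero_fiber_sum_eq_zero (Z f)
      (Finset.nonempty_iff_ne_empty.2 hne) (fun h => ({h, mate S₁ h} : Finset H))
      (fun h => ({h, mate S₂ h} : Finset H))
      (fun h hh => ⟨mate S₁ h, mem1 h hh, h₁.mate_ne (memU hh), by
        rw [h₁.mate_mate, Finset.pair_comm]⟩)
      (fun h hh => ⟨mate S₂ h, mem2 h hh, h₂.mate_ne (hU ▸ memU hh), by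
        rw [h₂.mate_mate, Finset.pair_comm]⟩)
    have hF' : F (f + f') := ⟨fun h => by
      simp only [Pi.add_apply, hf.1, h₁.apply_mate_eq_neg memU mem1 hf'Z hf'1]; ring, fun h => by
      simp only [Pi.add_apply, hf.2, h₂.apply_mate_eq_neg (hU ▸ memU) mem2 hf'Z hf'2]; ring⟩
    obtain ⟨h₀, hh₀⟩ := Function.ne_iff.1 hf'0
    have hh₀Z : h₀ ∈ Z f := by_contra fun hn => hh₀ (hf'Z _ hn)
    refine absurd (hmin _ hF') (not_le.2 (Finset.card_lt_card ⟨fun h hh => ?_, fun hsub => ?_⟩))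
    · by_contra hn
      simp only [Z, Finset.mem_filter, Pi.add_apply, hf'Z h hn, add_zero] at hh hn
      exact hn hh
    · have h1 := hsub hh₀Z
      simp only [Z, Finset.mem_filter, Pi.add_apply] at h1 hh₀Z
      rw [hh₀Z.2, zero_add] at h1
      exact hh₀ h1.2
  refine ⟨fun h => SignType.sign (f h), fun h hh => ?_, fun h => ?_, fun h => ?_⟩
  · have : f h ≠ 0 := fun h0 => by
      have : h ∈ Z f := Finset.mem_filter.2 ⟨hh, h0⟩
      rw [hZ] at this
      simp at this
    rcases lt_or_gt_of_ne this with h1 | h1 <;> simp [h1]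
  · simp only [hf.1, Left.sign_neg, SignType.coe_neg]
  · simp only [hf.2, Left.sign_neg, SignType.coe_neg]

end mate

/-! ### Opposite half-edges -/

namespace HalfEdgeGraph

variable {V H : Type*} (G : HalfEdgeGraph V H)

theorem isPairing_edges : IsPairing G.edges := ⟨G.card_edge, G.disjoint_edges⟩

variable [DecidableEq H]

/-- The other half-edge of the edge containing `h`. -/
noncomputable def opp (h : H) : H := mate G.edges h

theorem opp_opp (h : H) : G.opp (G.opp h) = h := G.isPairing_edges.mate_mate h

variable {G}

theorem pair_opp_mem {h : H} (hh : h ∈ G.halfEdges) : {h, G.opp h} ∈ G.edges :=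
  G.isPairing_edges.pair_mate_mem hh

theorem opp_eq {h h' : H} (hh : {h, h'} ∈ G.edges) : G.opp h = h' := G.isPairing_edges.mate_eq hh

theorem mem_halfEdges_of_mem {e : Finset H} {h : H} (he : e ∈ G.edges) (hh : h ∈ e) :
    h ∈ G.halfEdges := Finset.mem_biUnion.2 ⟨e, he, hh⟩

theorem opp_mem_iff {h : H} : G.opp h ∈ G.halfEdges ↔ h ∈ G.halfEdges :=
  G.isPairing_edges.mate_mem_iff

theorem opp_of_notMem {h : H} (hh : h ∉ G.halfEdges) : G.opp h = h := mate_of_notMem hh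

theorem eq_pair_opp {h : H} {e : Finset H} (he : e ∈ G.edges) (hh : h ∈ e) : e = {h, G.opp h} :=
  G.isPairing_edges.eq_pair_mate he hh

/-! ### Walks -/

/-- The first half-edge of a pair is opposite to the second half-edge of the preceding pair, and the
cyclic shift by one is invisible to multisets. -/
theorem IsClosedWalk.map_fst {W : Cycle (H × H)} (hW : G.IsClosedWalk W) :
    W.toMultiset.map Prod.fst = W.toMultiset.map fun p => G.opp p.2 := by
  have key : ∀ (l : List (H × H)) (a b : H × H),
      List.IsChain (fun p q : H × H => ({p.2, q.1} : Finset H) ∈ G.edges) (a :: (l ++ [b])) →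
      (l ++ [b]).map Prod.fst = (a :: l).map fun p => G.opp p.2 := by
    intro l
    induction l with
    | nil =>
      intro a b hc
      simp only [List.nil_append, List.isChain_cons_cons] at hc
      simp [opp_eq hc.1]
    | cons c l ih =>
      intro a b hc
      rw [List.cons_append, List.isChain_cons_cons] at hc
      rw [List.cons_append, List.map_cons, ih c b hc.2, List.map_cons, List.map_cons,
        opp_eq hc.1, List.map_cons]
  have hc := hW.2
  induction W with
  | nil => rfl
  | cons a l _ =>
    rw [Cycle.chain_coe_cons] at hc
    have h1 := Multiset.coe_eq_coe.1
      (congrArg (fun l : List H => (l : Multiset H)) (key l a a hc))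
    simp only [List.map_append, List.map_cons, List.map_nil] at h1
    simpa using (List.perm_append_singleton _ _).symm.trans h1

/-- The invariant is carried around the walk, alternately through a pair and across an edge. It will
be a component, or the quotient of a flow by an orientation. -/
theorem IsClosedWalk.forall_eq {X : Type*} {W : Cycle (H × H)} (hW : G.IsClosedWalk W)
    {k : H → X} (hk : ∀ p ∈ W, k p.1 = k p.2) (hopp : ∀ h ∈ G.halfEdges, k (G.opp h) = k h)
    {p q : H × H} (hp : p ∈ W) (hq : q ∈ W) : k p.1 = k q.1 := by
  have key : ∀ l : List (H × H), ∀ a b : H × H, (∀ p ∈ a :: l, k p.1 = k p.2) →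
      List.IsChain (fun p q : H × H => ({p.2, q.1} : Finset H) ∈ G.edges) (a :: (l ++ [b])) →
      ∀ p ∈ l, k p.1 = k a.1 := by
    intro l
    induction l with
    | nil => simp
    | cons c l ih =>
      intro a b hl hc p hp
      rw [List.cons_append, List.isChain_cons_cons] at hc
      have hca : k c.1 = k a.1 := by
        rw [hl a (by simp), ← opp_eq hc.1, hopp]
        exact mem_halfEdges_of_mem hc.1 (by simp)
      rcases List.mem_cons.1 hp with rfl | hp
      · exact hca
      · rw [ih c b (fun p hp => hl p (List.mem_cons_of_mem _ hp)) hc.2 p hp, hca]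
  have hc := hW.2
  induction W with
  | nil => exact absurd hp (Cycle.notMem_nil p)
  | cons a l _ =>
    rw [Cycle.chain_coe_cons] at hc
    have h1 : ∀ p ∈ a :: l, k p.1 = k a.1 := by
      intro p hp
      rcases List.mem_cons.1 hp with rfl | hp
      · rfl
      · exact key l a a (fun p hp => hk p hp) hc p hp
    rw [h1 p hp, h1 q hq]

theorem mem_toMultiset {α : Type*} {W : Cycle α} {p : α} : p ∈ W.toMultiset ↔ p ∈ W := by
  induction W using Quotient.inductionOn with
  | _ l => rfl

theorem IsOrientedCircuit.nodup_fst {W : Cycle (H × H)} (hW : G.IsOrientedCircuit W) :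
    (W.toMultiset.map Prod.fst).Nodup := (Multiset.nodup_add.1 hW.2.2).1

theorem IsOrientedCircuit.nodup_snd {W : Cycle (H × H)} (hW : G.IsOrientedCircuit W) :
    (W.toMultiset.map Prod.snd).Nodup := (Multiset.nodup_add.1 hW.2.2).2.1

theorem IsOrientedCircuit.fst_ne_snd {W : Cycle (H × H)} (hW : G.IsOrientedCircuit W)
    {p q : H × H} (hp : p ∈ W) (hq : q ∈ W) : p.1 ≠ q.2 := fun h =>
  Multiset.disjoint_left.1 (Multiset.nodup_add.1 hW.2.2).2.2
    (Multiset.mem_map_of_mem Prod.fst (mem_toMultiset.2 hp))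
    (h ▸ Multiset.mem_map_of_mem Prod.snd (mem_toMultiset.2 hq))

theorem IsClosedWalk.exists_fst_eq_opp {W : Cycle (H × H)} (hW : G.IsClosedWalk W) {p : H × H}
    (hp : p ∈ W) : ∃ q ∈ W, q.1 = G.opp p.2 := by
  have : G.opp p.2 ∈ W.toMultiset.map Prod.fst := by
    rw [hW.map_fst]
    exact Multiset.mem_map_of_mem (fun p : H × H => G.opp p.2) (mem_toMultiset.2 hp)
  obtain ⟨q, hq, h⟩ := Multiset.mem_map.1 this
  exact ⟨q, mem_toMultiset.1 hq, h⟩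

theorem IsClosedWalk.exists_snd_eq_opp {W : Cycle (H × H)} (hW : G.IsClosedWalk W) {p : H × H}
    (hp : p ∈ W) : ∃ q ∈ W, q.2 = G.opp p.1 := by
  have : p.1 ∈ W.toMultiset.map fun p => G.opp p.2 := by
    rw [← hW.map_fst]
    exact Multiset.mem_map_of_mem Prod.fst (mem_toMultiset.2 hp)
  obtain ⟨q, hq, h⟩ := Multiset.mem_map.1 this
  exact ⟨q, mem_toMultiset.1 hq, by rw [← h, opp_opp]⟩

theorem IsClosedWalk.snd_mem {W : Cycle (H × H)} (hW : G.IsClosedWalk W) {p : H × H}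
    (hp : p ∈ W) : p.2 ∈ G.halfEdges := by
  have key : ∀ l : List (H × H), ∀ a b : H × H,
      List.IsChain (fun p q : H × H => ({p.2, q.1} : Finset H) ∈ G.edges) (a :: (l ++ [b])) →
      ∀ p ∈ a :: l, p.2 ∈ G.halfEdges := by
    intro l
    induction l with
    | nil =>
      intro a b hc p hp
      simp only [List.nil_append, List.isChain_cons_cons] at hc
      obtain rfl := List.mem_singleton.1 hp
      exact mem_halfEdges_of_mem hc.1 (by simp)
    | cons c l ih =>
      intro a b hc p hp
      rw [List.cons_append, List.isChain_cons_cons] at hc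
      rcases List.mem_cons.1 hp with rfl | hp
      · exact mem_halfEdges_of_mem hc.1 (by simp)
      · exact ih c b hc.2 p hp
  have hc := hW.2
  induction W with
  | nil => exact absurd hp (Cycle.notMem_nil p)
  | cons a l _ => exact key l a a ((Cycle.chain_coe_cons _ _ _).1 hc) p hp

theorem IsClosedWalk.fst_mem {W : Cycle (H × H)} (hW : G.IsClosedWalk W) {p : H × H}
    (hp : p ∈ W) : p.1 ∈ G.halfEdges := by
  obtain ⟨q, hq, h⟩ := hW.exists_snd_eq_opp hp
  rw [← opp_mem_iff, ← h]
  exact hW.snd_mem hq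

/-- `P` stands for half-edges by which walks leave vertices: having left by `z`, a walk arrives by
`e z` and goes on by `n z`. Injectivity of `n` is not assumed, as it is automatic on a periodic
orbit; so the lemma serves both for arbitrary choices of a next half-edge and for transversals. -/
theorem isOrientedCircuit_map_periodicOrbit {n e : H → H} {P : Set H} (hn : ∀ z ∈ P, n z ∈ P)
    (hinc : ∀ z ∈ P, G.inc (e z) = G.inc (n z)) (he : ∀ z ∈ P, {z, e z} ∈ G.edges)
    (heP : ∀ z ∈ P, e z ∉ P) {y : H} (hy : y ∈ P) (hper : y ∈ Function.periodicPts n) :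
    G.IsOrientedCircuit ((Function.periodicOrbit n y).map fun z => (e z, n z)) := by
  have hiter : ∀ k, n^[k] y ∈ P := by
    intro k
    induction k with
    | zero => exact hy
    | succ k ih => rw [Function.iterate_succ_apply']; exact hn _ ih
  have hmem : ∀ z ∈ Function.periodicOrbit n y, z ∈ P := by
    intro z hz
    obtain ⟨k, rfl⟩ := (Function.mem_periodicOrbit_iff hper).1 hz
    exact hiter k
  have heinj : ∀ z ∈ P, ∀ z' ∈ P, e z = e z' → z = z' := by
    intro z hz z' hz' h
    have h1 := G.isPairing_edges.mate_eq' (he z hz)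
    rw [h, G.isPairing_edges.mate_eq' (he z' hz')] at h1
    exact h1.symm
  have hts : ∀ k : H × H → H, (((Function.periodicOrbit n y).map
      fun z => (e z, n z)).toMultiset.map k) =
      (Function.periodicOrbit n y).toMultiset.map fun z => k (e z, n z) := by
    intro k
    induction Function.periodicOrbit n y using Quotient.inductionOn with
    | _ l =>
      change ((Cycle.map _ (l : Cycle H)).toMultiset).map k = ((l : Cycle H).toMultiset).map _
      simp [Function.comp_def]
  have hnd : (Function.periodicOrbit n y).toMultiset.Nodup := by
    have := Function.nodup_periodicOrbit (f := n) (x := y)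
    revert this
    induction Function.periodicOrbit n y using Quotient.inductionOn with
    | _ l => exact fun h => h
  refine ⟨⟨?_, ?_⟩, ?_, ?_⟩
  · intro p hp
    obtain ⟨z, hz, rfl⟩ := Cycle.mem_map.1 hp
    exact hinc z (hmem z hz)
  · rw [Cycle.chain_map, Function.periodicOrbit_chain' _ hper]
    intro k
    simp only
    rw [Function.iterate_succ_apply']
    exact he _ (hn _ (hiter k))
  · rw [Ne, Cycle.map_eq_nil, Function.periodicOrbit_eq_nil_iff_not_periodic_pt]
    exact fun h => h hper
  · rw [hts, hts, Multiset.nodup_add]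
    refine ⟨Multiset.Nodup.map_on (fun z hz z' hz' h => heinj z (hmem z (mem_toMultiset.1 hz)) z'
      (hmem z' (mem_toMultiset.1 hz')) h) hnd, Multiset.Nodup.map_on ?_ hnd, ?_⟩
    · intro z hz z' hz' h
      obtain ⟨j, rfl⟩ := (Function.mem_periodicOrbit_iff hper).1 (mem_toMultiset.1 hz)
      obtain ⟨k, rfl⟩ := (Function.mem_periodicOrbit_iff hper).1 (mem_toMultiset.1 hz')
      -- On an orbit with period `N`, the map `n` is undone by `N - 1` further steps.
      obtain ⟨N, hN, hp⟩ := hper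
      have h' : n^[N - 1] (n (n^[j] y)) = n^[N - 1] (n (n^[k] y)) := by
        rw [show n (n^[j] y) = n (n^[k] y) from h]
      have hback : ∀ i, n^[N - 1] (n (n^[i] y)) = n^[i] y := by
        intro i
        rw [← Function.iterate_succ_apply, show (N - 1).succ = N by omega]
        exact hp.apply_iterate i
      rwa [hback, hback] at h'
    · rw [Multiset.disjoint_left]
      intro a ha hb
      obtain ⟨z, hz, rfl⟩ := Multiset.mem_map.1 ha
      obtain ⟨z', hz', h⟩ := Multiset.mem_map.1 hb
      exact heP z (hmem z (mem_toMultiset.1 hz)) 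
        ((show n z' = e z from h) ▸ hn _ (hmem z' (mem_toMultiset.1 hz')))

end HalfEdgeGraph

theorem Finset.sum_mul_count {H : Type*} [Fintype H] [DecidableEq H] (M : Multiset H) (φ : H → ℚ) :
    ∑ h, φ h * (M.count h : ℚ) = (M.map φ).sum := by
  induction M using Multiset.induction_on with
  | empty => simp
  | cons a M ih =>
    simp only [Multiset.count_cons, Nat.cast_add, mul_add, Finset.sum_add_distrib, ih,
      Multiset.map_cons, Multiset.sum_cons]
    simp [add_comm]

namespace HalfEdgeGraph

variable {V H : Type*} [DecidableEq H] {F : HalfEdgeGraph V H}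

/-! ### Flows -/

/-- The flow along a closed walk, as an antisymmetric function on half-edges. -/
noncomputable def walkFlow (F : HalfEdgeGraph V H) (W : Cycle (H × H)) (h : H) : ℚ :=
  ((W.toMultiset.map Prod.snd).count h : ℚ) - ((W.toMultiset.map Prod.snd).count (F.opp h) : ℚ)

theorem opp_injective : Function.Injective F.opp := F.isPairing_edges.mate_injective

/-- Leaving a vertex by `F.opp h` amounts to arriving by `h`, so the flow counts departures minus
arrivals. -/
theorem IsClosedWalk.walkFlow_eq {W : Cycle (H × H)} (hW : F.IsClosedWalk W) (h : H) :
    F.walkFlow W h = ((W.toMultiset.map Prod.snd).count h : ℚ) -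
      ((W.toMultiset.map Prod.fst).count h : ℚ) := by
  have : W.toMultiset.map Prod.fst = (W.toMultiset.map Prod.snd).map F.opp := by
    rw [hW.map_fst, Multiset.map_map]; rfl
  rw [walkFlow, this]
  conv_rhs => rw [← F.opp_opp h, Multiset.count_map_eq_count' _ _ opp_injective, F.opp_opp]

theorem walkFlow_opp (W : Cycle (H × H)) (h : H) : F.walkFlow W (F.opp h) = - F.walkFlow W h := by
  simp [walkFlow, opp_opp]

theorem IsOrientedCircuit.walkFlow_snd {W : Cycle (H × H)} (hW : F.IsOrientedCircuit W)
    {p : H × H} (hp : p ∈ W) : F.walkFlow W p.2 = 1 := by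
  rw [hW.1.walkFlow_eq, Multiset.count_eq_one_of_mem hW.nodup_snd
    (Multiset.mem_map_of_mem _ (mem_toMultiset.2 hp)), Multiset.count_eq_zero_of_notMem]
  · simp
  · intro h
    obtain ⟨q, hq, h⟩ := Multiset.mem_map.1 h
    exact hW.fst_ne_snd (mem_toMultiset.1 hq) hp h

theorem IsClosedWalk.walkFlow_eq_zero {W : Cycle (H × H)} (hW : F.IsClosedWalk W) {h : H}
    (hh : ∀ p ∈ W, h ≠ p.1 ∧ h ≠ p.2) : F.walkFlow W h = 0 := by
  rw [hW.walkFlow_eq, Multiset.count_eq_zero_of_notMem, Multiset.count_eq_zero_of_notMem]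
  · simp
  · intro h
    obtain ⟨q, hq, h⟩ := Multiset.mem_map.1 h
    exact (hh q (mem_toMultiset.1 hq)).1 h.symm
  · intro h
    obtain ⟨q, hq, h⟩ := Multiset.mem_map.1 h
    exact (hh q (mem_toMultiset.1 hq)).2 h.symm

theorem walkFlow_int (W : Cycle (H × H)) (h : H) : ∃ z : ℤ, F.walkFlow W h = z :=
  ⟨((W.toMultiset.map Prod.snd).count h : ℤ) - ((W.toMultiset.map Prod.snd).count (F.opp h) : ℤ),
    by simp [walkFlow]⟩

/-- Elements of `H` on no edge are fixed by `F.opp`, so there `f h = - f h`. Sums over all of `H`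
may thus ignore them. -/
theorem eq_zero_of_skew {f : H → ℚ} (hf : ∀ h, f (F.opp h) = - f h) {h : H}
    (hh : h ∉ F.halfEdges) : f h = 0 := by
  have := hf h
  rw [opp_of_notMem hh] at this
  linarith

theorem deleteEdges_isClosedWalk {E : Finset (Finset H)} {W : Cycle (H × H)}
    (hW : (F.deleteEdges E).IsClosedWalk W) : F.IsClosedWalk W :=
  ⟨hW.1, hW.2.imp fun _ _ h => (Finset.mem_sdiff.1 h).1⟩

theorem deleteEdges_isOrientedCircuit {E : Finset (Finset H)} {W : Cycle (H × H)}
    (hW : (F.deleteEdges E).IsOrientedCircuit W) : F.IsOrientedCircuit W :=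
  ⟨deleteEdges_isClosedWalk hW.1, hW.2⟩

theorem IsClosedWalk.traverses {W : Cycle (H × H)} (hW : F.IsClosedWalk W) {p : H × H}
    (hp : p ∈ W) {h : H} (hh : h = p.1 ∨ h = p.2) {e : Finset H} (he : e ∈ F.edges)
    (hhe : h ∈ e) : Traverses W e := by
  rw [eq_pair_opp he hhe]
  intro a ha
  simp only [Finset.mem_insert, Finset.mem_singleton] at ha
  rcases ha with rfl | rfl
  · exact ⟨p, hp, hh⟩
  · rcases hh with rfl | rfl
    · obtain ⟨q, hq, h⟩ := hW.exists_snd_eq_opp hp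
      exact ⟨q, hq, Or.inr h.symm⟩
    · obtain ⟨q, hq, h⟩ := hW.exists_fst_eq_opp hp
      exact ⟨q, hq, Or.inl h.symm⟩

theorem DirectedVersion.opp_tail (D : F.DirectedVersion) (e : F.edges) :
    F.opp (D.tail e) = D.head e := opp_eq (by rw [D.tail_head]; exact e.2)

theorem DirectedVersion.tail_ne_head (D : F.DirectedVersion) (e : F.edges) :
    D.tail e ≠ D.head e := F.isPairing_edges.ne_of_mem (by rw [D.tail_head]; exact e.2)

section

variable [DecidableEq V] [Fintype H]

/-- The flows of `F` that vanish on the edges in `E`. -/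
def flows (F : HalfEdgeGraph V H) (E : Finset (Finset H)) : Submodule ℚ (H → ℚ) where
  carrier := {f | (∀ h, f (F.opp h) = - f h) ∧ (∀ v, ∑ h with F.inc h = v, f h = 0) ∧
    ∀ e ∈ E, ∀ h ∈ e, f h = 0}
  add_mem' := fun {f g} hf hg => ⟨fun h => by simp only [Pi.add_apply, hf.1, hg.1]; ring,
    fun v => by simp only [Pi.add_apply, Finset.sum_add_distrib, hf.2.1, hg.2.1, add_zero],
    fun e he h hh => by simp only [Pi.add_apply, hf.2.2 e he h hh, hg.2.2 e he h hh, add_zero]⟩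
  zero_mem' := by simp
  smul_mem' := fun c f hf => ⟨fun h => by simp only [Pi.smul_apply, hf.1, smul_eq_mul]; ring,
    fun v => by simp only [Pi.smul_apply, ← Finset.smul_sum, hf.2.1, smul_zero],
    fun e he h hh => by simp only [Pi.smul_apply, hf.2.2 e he h hh, smul_zero]⟩

/-- Each pair of the walk is one arrival and one departure at the same vertex. -/
theorem IsClosedWalk.sum_walkFlow {W : Cycle (H × H)} (hW : F.IsClosedWalk W) (v : V) :
    ∑ h with F.inc h = v, F.walkFlow W h = 0 := by
  have : ∀ h, (if F.inc h = v then F.walkFlow W h else 0) =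
      (if F.inc h = v then 1 else 0) * ((W.toMultiset.map Prod.snd).count h : ℚ) -
      (if F.inc h = v then 1 else 0) * ((W.toMultiset.map Prod.fst).count h : ℚ) := by
    intro h
    rw [hW.walkFlow_eq]
    split_ifs <;> simp
  rw [Finset.sum_filter, Finset.sum_congr rfl fun h _ => this h, Finset.sum_sub_distrib,
    Finset.sum_mul_count, Finset.sum_mul_count, Multiset.map_map, Multiset.map_map, sub_eq_zero]
  refine congrArg _ (Multiset.map_congr rfl fun p hp => ?_)
  simp only [Function.comp_apply, hW.1 p (mem_toMultiset.1 hp)]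

theorem flows_mono {E E' : Finset (Finset H)} (h : E ⊆ E') : F.flows E' ≤ F.flows E :=
  fun _ hf => ⟨hf.1, hf.2.1, fun e he => hf.2.2 e (h he)⟩

theorem walkFlow_mem_flows {E : Finset (Finset H)} (hE : E ⊆ F.edges) {W : Cycle (H × H)}
    (hW : (F.deleteEdges E).IsClosedWalk W) : F.walkFlow W ∈ F.flows E := by
  have hW' := deleteEdges_isClosedWalk hW
  refine ⟨walkFlow_opp W, hW'.sum_walkFlow, fun e he h hh => hW'.walkFlow_eq_zero ?_⟩
  have key : h ∉ (F.deleteEdges E).halfEdges := by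
    intro hmem
    obtain ⟨e', he', hh'⟩ := Finset.mem_biUnion.1 hmem
    have he'' := Finset.mem_sdiff.1 he'
    rw [F.isPairing_edges.eq_of_mem (hE he) he''.1 hh hh'] at he
    exact he''.2 he
  exact fun p hp => ⟨fun h1 => key (h1 ▸ hW.fst_mem hp), fun h1 => key (h1 ▸ hW.snd_mem hp)⟩

/-- A flow supported on a forest vanishes. -/
theorem IsForest.eq_zero_of_flow {E T : Finset (Finset H)}
    (hT : (F.deleteEdges E).IsForest T) {f : H → ℚ} (hf : f ∈ F.flows E)
    (hfT : ∀ e ∈ (F.deleteEdges E).edges \ T, ∀ h ∈ e, f h = 0) : f = 0 := by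
  by_contra hne
  obtain ⟨h₀, hh₀⟩ : ∃ h, 0 < f h := by
    obtain ⟨h, hh⟩ := Function.ne_iff.1 hne
    rcases lt_or_gt_of_ne hh with h1 | h1
    · exact ⟨F.opp h, by rw [hf.1]; simpa using h1⟩
    · exact ⟨h, h1⟩
  -- Positive flow through `z` enters the next vertex by `F.opp z`, so by conservation some
  -- half-edge there carries positive flow out. Where `f z` is not positive, the value is a dummy.
  have hnext : ∀ z, ∃ z', 0 < f z → 0 < f z' ∧ F.inc (F.opp z) = F.inc z' := by
    intro z
    by_cases hz : 0 < f z
    · by_contra! hcon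
      have hsum := hf.2.1 (F.inc (F.opp z))
      refine absurd hsum (ne_of_lt ?_)
      refine Finset.sum_neg' (fun h hh => ?_) ⟨F.opp z, by simp, ?_⟩
      · by_contra! hpos
        exact (hcon h).2 hpos (Finset.mem_filter.1 hh).2.symm
      · rw [hf.1]; linarith
    · exact ⟨z, fun h => absurd h hz⟩
  choose n hn using hnext
  have hiter : ∀ k, 0 < f (n^[k] h₀) := by
    intro k
    induction k with
    | zero => exact hh₀
    | succ k ih => rw [Function.iterate_succ_apply']; exact (hn _ ih).1
  -- As `H` is finite, the walk along positive flow eventually repeats. Its periodic part is a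
  -- circuit in the support of `f`, hence in the forest.
  obtain ⟨y, hy, hper⟩ : ∃ y, 0 < f y ∧ y ∈ Function.periodicPts n := by
    obtain ⟨i, j, hij, he⟩ := Finite.exists_ne_map_eq_of_infinite fun k : ℕ => n^[k] h₀
    wlog hlt : i < j generalizing i j
    · exact this j i hij.symm he.symm (by omega)
    refine ⟨_, hiter i, j - i, by omega, ?_⟩
    change n^[j - i] (n^[i] h₀) = _
    rw [← Function.iterate_add_apply, Nat.sub_add_cancel hlt.le]
    exact he.symm
  have hmem : ∀ z, f z ≠ 0 → z ∈ F.halfEdges := fun z hz =>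
    by_contra fun hn => hz (eq_zero_of_skew hf.1 hn)
  have hW := isOrientedCircuit_map_periodicOrbit (G := F.deleteEdges E) (n := n) (e := F.opp)
    (P := {h | 0 < f h}) (fun z hz => (hn z hz).1) (fun z hz => (hn z hz).2)
    (fun z hz => by
      have hz : 0 < f z := hz
      refine Finset.mem_sdiff.2 ⟨pair_opp_mem (hmem z hz.ne'), fun hE => hz.ne' ?_⟩
      exact hf.2.2 _ hE z (by simp))
    (fun z hz => by
      have hz : 0 < f z := hz
      simp only [Set.mem_ofPred_eq, hf.1]; linarith)
    hy hper
  refine hT.2 ⟨_, hW, fun e he htr => ?_⟩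
  by_contra heT
  obtain ⟨a, ha⟩ : e.Nonempty := by
    rw [← Finset.card_pos, (F.deleteEdges E).card_edge e he]; norm_num
  have hfa := hfT e (Finset.mem_sdiff.2 ⟨he, heT⟩) a ha
  obtain ⟨p, hp, hap⟩ := htr a ha
  obtain ⟨z, hz, rfl⟩ := Cycle.mem_map.1 hp
  obtain ⟨k, rfl⟩ := (Function.mem_periodicOrbit_iff hper).1 hz
  have hpos : 0 < f (n^[k] y) := by
    clear hz hap hp
    induction k with
    | zero => exact hy
    | succ k ih => rw [Function.iterate_succ_apply']; exact (hn _ ih).1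
  rcases hap with h1 | h1
  · rw [h1] at hfa
    simp only [hf.1] at hfa
    linarith
  · have := (hn _ hpos).1
    simp only at h1
    rw [← h1, hfa] at this
    exact lt_irrefl _ this

/-- A family of integral flows with coordinates given by evaluation at half-edges. -/
structure IsFlowBasis (F : HalfEdgeGraph V H) (E : Finset (Finset H)) {B : Type*}
    (w : B → H → ℚ) (a : B → H) : Prop where
  mem : ∀ b, w b ∈ F.flows E
  int : ∀ b h, ∃ z : ℤ, w b h = z
  self : ∀ b, w b (a b) = 1
  ne : ∀ b b', b ≠ b' → w b (a b') = 0
  ext : ∀ f ∈ F.flows E, (∀ b, f (a b) = 0) → f = 0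

/-- A fundamental circuit traverses a single non-forest edge, so evaluating at half-edges of the
non-forest edges yields coordinates dual to the walk flows. A flow with all coordinates zero is
supported on the forest, so it vanishes. -/
theorem IsStrictlyFundamentalCycleBasis.exists_isFlowBasis {E : Finset (Finset H)}
    (hE : E ⊆ F.edges) {B : Finset (Cycle (H × H))}
    (hB : (F.deleteEdges E).IsStrictlyFundamentalCycleBasis B) :
    ∃ a : B → H, F.IsFlowBasis E (fun W : B => F.walkFlow W.1) a := by
  obtain ⟨T, hT, hB1, hB2⟩ := hB
  have hex : ∀ W : B, ∃ e ∈ (F.deleteEdges E).edges \ T,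
      (F.deleteEdges E).IsFundamentalCircuit T e W.1 ∧ ∃ p ∈ W.1, p.2 ∈ e := by
    intro W
    obtain ⟨e, he, hW⟩ := hB1 W.1 W.2
    refine ⟨e, he, hW, ?_⟩
    have htr := (hW.2 e he).2 rfl
    have he' := (Finset.mem_sdiff.1 (Finset.mem_sdiff.1 he).1).1
    obtain ⟨h, hh⟩ : e.Nonempty := by
      rw [← Finset.card_pos, F.card_edge e he']; norm_num
    obtain ⟨p, hp, h1 | h1⟩ := htr h hh
    -- The walk flow is `1` rather than `-1` at second entries of pairs, so a first entry is
    -- exchanged for its opposite.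
    · obtain ⟨q, hq, hqp⟩ := (deleteEdges_isClosedWalk hW.1.1).exists_snd_eq_opp hp
      refine ⟨q, hq, ?_⟩
      rw [hqp, ← h1, eq_pair_opp he' hh]
      simp
    · exact ⟨p, hp, h1 ▸ hh⟩
  choose e he hfund p hp hpe using hex
  have heF : ∀ W, e W ∈ F.edges := fun W =>
    (Finset.mem_sdiff.1 (Finset.mem_sdiff.1 (he W)).1).1
  have hcirc : ∀ W : B, F.IsOrientedCircuit W.1 := fun W =>
    deleteEdges_isOrientedCircuit (hfund W).1
  refine ⟨fun W => (p W).2, ⟨fun W => walkFlow_mem_flows hE (hfund W).1.1,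
    fun W h => walkFlow_int W.1 h, fun W => (hcirc W).walkFlow_snd (hp W), fun W W' hne => ?_,
    fun f hf h0 => ?_⟩⟩
  · refine (hcirc W).1.walkFlow_eq_zero fun q hq => ?_
    rw [← not_or]
    intro hor
    have htr := (hcirc W).1.traverses hq hor (heF W') (hpe W')
    have heq := ((hfund W).2 _ (he W')).1 htr
    obtain ⟨U, -, hU⟩ := hB2 _ (he W')
    apply hne
    apply Subtype.ext
    rw [hU W'.1 ⟨W'.2, hfund W'⟩, hU W.1 ⟨W.2, heq ▸ hfund W⟩]
  · refine hT.1.eq_zero_of_flow hf fun e' he' h hh => ?_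
    obtain ⟨W, ⟨hW, hWf⟩, -⟩ := hB2 e' he'
    have heq : e ⟨W, hW⟩ = e' := (hWf.2 _ (he ⟨W, hW⟩)).1
      (((hfund ⟨W, hW⟩).2 _ (he ⟨W, hW⟩)).2 rfl)
    have h1 := eq_pair_opp (heF ⟨W, hW⟩) (hpe ⟨W, hW⟩)
    rw [← heq, h1] at hh
    simp only [Finset.mem_insert, Finset.mem_singleton] at hh
    rcases hh with rfl | rfl
    · exact h0 _
    · rw [hf.1, h0, neg_zero]

/-! ### Coordinates with respect to a flow basis -/

section IsFlowBasis

variable {E : Finset (Finset H)} {B : Type*} [Fintype B] {w : B → H → ℚ} {a : B → H}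

theorem IsFlowBasis.sum_apply (h : F.IsFlowBasis E w a) (c : B → ℚ) (b : B) :
    ∑ b', c b' * w b' (a b) = c b := by
  classical
  rw [Finset.sum_eq_single b, h.self, mul_one]
  · intro b' _ hne
    rw [h.ne _ _ hne, mul_zero]
  · simp

theorem IsFlowBasis.sum_mem (h : F.IsFlowBasis E w a) (c : B → ℚ) :
    (fun x => ∑ b, c b * w b x) ∈ F.flows E := by
  have : (fun x => ∑ b, c b * w b x) = ∑ b, c b • w b := by ext x; simp
  rw [this]
  exact Submodule.sum_mem _ fun b _ => Submodule.smul_mem _ _ (h.mem b)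

theorem IsFlowBasis.eq_sum (h : F.IsFlowBasis E w a) {f : H → ℚ} (hf : f ∈ F.flows E) (x : H) :
    f x = ∑ b, f (a b) * w b x := by
  have := h.ext _ (Submodule.sub_mem _ hf (h.sum_mem fun b => f (a b))) fun b => by
    simp only [Pi.sub_apply, h.sum_apply, sub_self]
  exact sub_eq_zero.1 (congrFun this x)

/-- The flows in terms of their coordinates with respect to a flow basis. -/
noncomputable def IsFlowBasis.equiv (h : F.IsFlowBasis E w a) : (B → ℚ) ≃ₗ[ℚ] F.flows E where
  toFun c := ⟨fun x => ∑ b, c b * w b x, h.sum_mem c⟩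
  map_add' c d := by ext x; simp [add_mul, Finset.sum_add_distrib]
  map_smul' k c := by ext x; simp [Finset.mul_sum, mul_assoc]
  invFun f b := f.1 (a b)
  left_inv c := by ext b; exact h.sum_apply c b
  right_inv f := by ext x; exact (h.eq_sum f.2 x).symm

end IsFlowBasis

end

/-! ### Entries of the representation matrix -/

section

variable [DecidableEq V]

theorem IsTransitionAt.subset_star {v : V} {t : Finset (Finset H)} {s : Finset H}
    (ht : F.IsTransitionAt v t) (hs : s ∈ t) : s ⊆ F.star v := by
  rw [← ht.2.2]
  exact Finset.subset_biUnion_of_mem id hs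

/-- Compare the contributions edge by edge. An edge with one half-edge in `o t` contributes the flow
at that half-edge; an edge inside `o t` contributes `0` on the left by definition and on the right
by antisymmetry. -/
theorem representationMatrix_apply (B : Finset (Cycle (H × H))) (D : F.DirectedVersion)
    (o : F.TransitionalOrientation) (W : B) (t : F.Transition) :
    F.representationMatrix B D o W t = ∑ h ∈ o.1 t, F.walkFlow W.1 h := by
  have hsub : o.1 t ⊆ F.halfEdges := by
    obtain ⟨v, hv⟩ := t.2
    exact (hv.subset_star (o.2 t)).trans
      (Finset.filter_subset _ _)
  have hR : ∑ h ∈ o.1 t, F.walkFlow W.1 h =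
      ∑ e : F.edges, ∑ h ∈ e.1, if h ∈ o.1 t then F.walkFlow W.1 h else 0 := by
    rw [Finset.sum_coe_sort F.edges fun e => ∑ h ∈ e, if h ∈ o.1 t then F.walkFlow W.1 h else 0]
    have := Finset.sum_biUnion (s := F.edges) (t := id)
      (f := fun h => if h ∈ o.1 t then F.walkFlow W.1 h else 0)
      (fun e he e' he' hne => F.disjoint_edges e he e' he' hne)
    simp only [id] at this
    rw [← this, Finset.sum_ite_mem]
    exact Finset.sum_congr (Finset.inter_eq_right.2 hsub).symm fun _ _ => rfl
  rw [hR, representationMatrix, Matrix.mul_apply]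
  refine Finset.sum_congr rfl fun e _ => ?_
  have hne := D.tail_ne_head e
  have he : e.1 = {D.tail e, D.head e} := (D.tail_head e).symm
  have hinc : ((F.cycleMatrix B D).map (Int.cast : ℤ → ℚ)) W e = F.walkFlow W.1 (D.tail e) := by
    simp [cycleMatrix, incidenceVector, walkFlow, D.opp_tail]
  have hhead : F.walkFlow W.1 (D.head e) = - F.walkFlow W.1 (D.tail e) := by
    rw [← D.opp_tail, walkFlow_opp]
  have hmat : edgeTransitionMatrix D o e t =
      (if D.tail e ∈ o.1 t then 1 else 0) - (if D.head e ∈ o.1 t then 1 else 0) := by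
    simp only [edgeTransitionMatrix, Matrix.of_apply, he]
    by_cases h1 : D.tail e ∈ o.1 t <;> by_cases h2 : D.head e ∈ o.1 t <;>
      simp [h1, h2, Finset.insert_inter_of_mem, Finset.insert_inter_of_notMem,
        Finset.singleton_inter_of_mem, Finset.singleton_inter_of_notMem, hne, hne.symm,
        Finset.ext_iff]
  rw [hinc, hmat, he, Finset.sum_pair hne, hhead]
  split_ifs <;> simp

end

end HalfEdgeGraph

/-! ### Components -/

namespace HalfEdgeGraph

variable {V H : Type*} {F : HalfEdgeGraph V H}

/-- The component of the vertex to which a half-edge is incident. -/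
def comp (F : HalfEdgeGraph V H) (h : H) : F.Component := Quot.mk F.Adj (F.inc h)

theorem OneEdgePerComponent.eq_of_comp_eq {E : Finset (Finset H)} (hE : F.OneEdgePerComponent E)
    {e e' : Finset H} (he : e ∈ E) (he' : e' ∈ E) {h h' : H}
    (hh : h ∈ e) (hh' : h' ∈ e') (hc : F.comp h = F.comp h') : e = e' :=
  (hE.2 (F.comp h)).unique ⟨he, h, hh, rfl⟩ ⟨he', h', hh', hc.symm⟩

theorem comp_opp [DecidableEq H] (h : H) : F.comp (F.opp h) = F.comp h := by
  by_cases hh : h ∈ F.halfEdges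
  · exact Quot.sound ⟨_, pair_opp_mem hh, _, by simp, h, by simp, rfl, rfl⟩
  · rw [opp_of_notMem hh]

variable [DecidableEq H] [DecidableEq V]

/-! ### Transitions -/

theorem mem_star {v : V} {h : H} : h ∈ F.star v ↔ h ∈ F.halfEdges ∧ F.inc h = v :=
  Finset.mem_filter

namespace IsTransitionAt

variable {v v' : V} {t : Finset (Finset H)}

theorem isPairing (ht : F.IsTransitionAt v t) : IsPairing t := ⟨ht.1, ht.2.1⟩

theorem pair_mate_mem (ht : F.IsTransitionAt v t) {a : H} (ha : a ∈ F.star v) :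
    {a, mate t a} ∈ t := ht.isPairing.pair_mate_mem (ht.2.2 ▸ ha)

theorem mate_mem (ht : F.IsTransitionAt v t) {a : H} (ha : a ∈ F.star v) :
    mate t a ∈ F.star v := by
  rw [← ht.2.2]; exact ht.isPairing.mate_mem (ht.2.2 ▸ ha)

theorem mate_ne (ht : F.IsTransitionAt v t) {a : H} (ha : a ∈ F.star v) :
    mate t a ≠ a := ht.isPairing.mate_ne (ht.2.2 ▸ ha)

theorem nonempty (hF : F.IsRegular 4) (ht : F.IsTransitionAt v t) : t.Nonempty := by
  have h4 := hF v
  rw [← ht.2.2] at h4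
  rw [Finset.nonempty_iff_ne_empty]
  rintro rfl
  simp at h4

theorem eq_pair (hF : F.IsRegular 4) (ht : F.IsTransitionAt v t) {s : Finset H} (hs : s ∈ t) :
    t = {s, F.star v \ s} := by
  have hcard : t.card = 2 := by
    have h4 := hF v
    rw [← ht.2.2, Finset.card_biUnion (t := id) fun e he e' he' hne => ht.2.1 e he e' he' hne,
      show ∑ u ∈ t, (id u).card = ∑ u ∈ t, 2 from Finset.sum_congr rfl ht.1] at h4
    simp only [Finset.sum_const, smul_eq_mul] at h4
    omega
  obtain ⟨x, y, hxy, rfl⟩ := Finset.card_eq_two.1 hcard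
  have hdis := ht.2.1 x (by simp) y (by simp) hxy
  have hU : F.star v = x ∪ y := by rw [← ht.2.2]; ext; simp
  simp only [Finset.mem_insert, Finset.mem_singleton] at hs
  rcases hs with rfl | rfl
  · rw [hU, Finset.union_sdiff_left, Finset.sdiff_eq_self_of_disjoint hdis.symm]
  · rw [hU, Finset.union_sdiff_right, Finset.sdiff_eq_self_of_disjoint hdis, Finset.pair_comm]

theorem vertex_unique (hF : F.IsRegular 4) (ht : F.IsTransitionAt v t)
    (ht' : F.IsTransitionAt v' t) : v = v' := by
  obtain ⟨s, hs⟩ := ht.nonempty hF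
  obtain ⟨a, ha⟩ : s.Nonempty := by rw [← Finset.card_pos, ht.1 s hs]; norm_num
  exact (mem_star.1 (ht.subset_star hs ha)).2.symm.trans (mem_star.1 (ht'.subset_star hs ha)).2

end IsTransitionAt

theorem isTransitionAt_pair (hF : F.IsRegular 4) {v : V} {a m : H} (ha : a ∈ F.star v)
    (hm : m ∈ F.star v) (hne : m ≠ a) :
    F.IsTransitionAt v {{a, m}, F.star v \ {a, m}} := by
  have hsub : {a, m} ⊆ F.star v := by
    intro x hx
    simp only [Finset.mem_insert, Finset.mem_singleton] at hx
    rcases hx with rfl | rfl <;> assumption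
  have h2 : ({a, m} : Finset H).card = 2 := Finset.card_pair hne.symm
  refine ⟨fun s hs => ?_, fun s hs s' hs' hss' => ?_, ?_⟩
  · simp only [Finset.mem_insert, Finset.mem_singleton] at hs
    rcases hs with rfl | rfl
    · exact h2
    · rw [Finset.card_sdiff_of_subset hsub, h2, hF v]
  · simp only [Finset.mem_insert, Finset.mem_singleton] at hs hs'
    rcases hs with rfl | rfl <;> rcases hs' with rfl | rfl
    · exact absurd rfl hss'
    · exact Finset.disjoint_sdiff
    · exact Finset.sdiff_disjoint
    · exact absurd rfl hss'
  · rw [Finset.biUnion_insert, Finset.singleton_biUnion]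
    exact Finset.union_sdiff_of_subset hsub

theorem star_nonempty (hF : F.IsRegular 4) (v : V) : (F.star v).Nonempty := by
  rw [← Finset.card_pos, hF v]; norm_num

/-- A transition is determined by the partner of one fixed half-edge at `v`, and each of the other
three can be the partner. -/
theorem ncard_transitions (hF : F.IsRegular 4) (v : V) :
    {t : F.Transition | F.IsTransitionAt v t.1}.ncard = 3 := by
  obtain ⟨a, ha⟩ := star_nonempty hF v
  have h3 : ((F.star v).erase a).card = 3 := by rw [Finset.card_erase_of_mem ha, hF v]
  rw [← h3, ← Set.ncard_coe_finset]
  refine Set.ncard_congr (fun t _ => mate t.1 a) (fun t ht => ?_) (fun t t' ht ht' h => ?_)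
    (fun m hm => ?_)
  · exact Finset.mem_coe.2 (Finset.mem_erase.2
      ⟨IsTransitionAt.mate_ne ht ha, IsTransitionAt.mate_mem ht ha⟩)
  · have ht : F.IsTransitionAt v t.1 := ht
    have ht' : F.IsTransitionAt v t'.1 := ht'
    apply Subtype.ext
    rw [ht.eq_pair hF (ht.pair_mate_mem ha), ht'.eq_pair hF (ht'.pair_mate_mem ha), h]
  · obtain ⟨hne, hm⟩ := Finset.mem_erase.1 (Finset.mem_coe.1 hm)
    have ht := isTransitionAt_pair hF ha hm hne
    exact ⟨⟨_, v, ht⟩, ht, ht.isPairing.mate_eq (by simp)⟩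

theorem exists_transitionAt (hF : F.IsRegular 4) (v : V) :
    ∃ t : F.Transition, F.IsTransitionAt v t.1 := by
  have := Set.nonempty_of_ncard_ne_zero (s := {t : F.Transition | F.IsTransitionAt v t.1})
    (by rw [ncard_transitions hF]; norm_num)
  exact this

/-- Two distinct transitions at a vertex, and the third one. -/
theorem exists_star_eq (hF : F.IsRegular 4) {v : V} {x y : Finset (Finset H)}
    (hx : F.IsTransitionAt v x) (hy : F.IsTransitionAt v y) (hxy : x ≠ y) :
    ∃ a b c d, F.star v = {a, b, c, d} ∧ a ≠ b ∧ a ≠ c ∧ a ≠ d ∧ b ≠ c ∧ b ≠ d ∧ c ≠ d ∧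
      {a, b} ∈ x ∧ {c, d} ∈ x ∧ {a, c} ∈ y ∧ {b, d} ∈ y ∧
      ∃ z, F.IsTransitionAt v z ∧ {a, d} ∈ z ∧ {b, c} ∈ z := by
  obtain ⟨a, ha⟩ := star_nonempty hF v
  have hbx := hx.pair_mate_mem ha
  have hcy := hy.pair_mate_mem ha
  have hb := hx.mate_mem ha
  have hc := hy.mate_mem ha
  have hba := hx.mate_ne ha
  have hca := hy.mate_ne ha
  have hx' := hx.eq_pair hF hbx
  have hy' := hy.eq_pair hF hcy
  set b := mate x a
  set c := mate y a
  have hbc : b ≠ c := by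
    intro h
    rw [h] at hx'
    exact hxy (hx'.trans hy'.symm)
  have hsub : {a, b, c} ⊆ F.star v := by
    intro u hu
    simp only [Finset.mem_insert, Finset.mem_singleton] at hu
    rcases hu with rfl | rfl | rfl <;> assumption
  have h3 : ({a, b, c} : Finset H).card = 3 := by
    rw [Finset.card_eq_three]
    exact ⟨a, b, c, hba.symm, hca.symm, hbc, rfl⟩
  have h1 : (F.star v \ {a, b, c}).card = 1 := by
    rw [Finset.card_sdiff_of_subset hsub, h3, hF v]
  obtain ⟨d, hd⟩ := Finset.card_eq_one.1 h1
  have hdm : d ∈ F.star v \ {a, b, c} := by rw [hd]; simp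
  simp only [Finset.mem_sdiff, Finset.mem_insert, Finset.mem_singleton, not_or] at hdm
  obtain ⟨hds, hda, hdb, hdc⟩ := hdm
  have hstar : F.star v = {a, b, c, d} := by
    rw [← Finset.union_sdiff_of_subset hsub, hd]
    ext u
    simp
  have hz := isTransitionAt_pair hF ha hds hda
  refine ⟨a, b, c, d, hstar, hba.symm, hca.symm, Ne.symm hda, hbc, Ne.symm hdb, Ne.symm hdc,
    hbx, ?_, hcy, ?_, _, hz, by simp, ?_⟩
  · rw [hx', hstar]
    refine Finset.mem_insert_of_mem (Finset.mem_singleton.2 ?_)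
    ext u; simp only [Finset.mem_insert, Finset.mem_singleton, Finset.mem_sdiff]; grind
  · rw [hy', hstar]
    refine Finset.mem_insert_of_mem (Finset.mem_singleton.2 ?_)
    ext u; simp only [Finset.mem_insert, Finset.mem_singleton, Finset.mem_sdiff]; grind
  · rw [hstar]
    refine Finset.mem_insert_of_mem (Finset.mem_singleton.2 ?_)
    ext u; simp only [Finset.mem_insert, Finset.mem_singleton, Finset.mem_sdiff]; grind

/-! ### Transversals -/

theorem isTransversal_iff {T : Set F.Transition} :
    IsTransversal F.skewClasses T ↔ ∀ v, ∃! t, t ∈ T ∧ F.IsTransitionAt v t.1 := by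
  constructor
  · exact fun h v => h _ ⟨v, rfl⟩
  · rintro h _ ⟨v, rfl⟩
    exact h v

theorem exists_isTransversal (hF : F.IsRegular 4) : ∃ T, IsTransversal F.skewClasses T := by
  choose t ht using exists_transitionAt hF
  refine ⟨Set.range t, isTransversal_iff.2 fun v => ⟨t v, ⟨⟨v, rfl⟩, ht v⟩, ?_⟩⟩
  rintro _ ⟨⟨v', rfl⟩, h⟩
  rw [(ht v').vertex_unique hF h]

theorem IsTransversal.update (hF : F.IsRegular 4) {T : Set F.Transition}
    (hT : IsTransversal F.skewClasses T) {v : V} {x : F.Transition}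
    (hx : F.IsTransitionAt v x.1) :
    IsTransversal F.skewClasses ({t | t ∈ T ∧ ¬ F.IsTransitionAt v t.1} ∪ {x}) := by
  rw [isTransversal_iff] at hT ⊢
  intro v'
  by_cases hv : v = v'
  · subst hv
    refine ⟨x, ⟨Or.inr rfl, hx⟩, ?_⟩
    rintro y ⟨hy | hy, hyv⟩
    · exact absurd hyv hy.2
    · exact hy
  · obtain ⟨t, ⟨htT, htv⟩, hu⟩ := hT v'
    refine ⟨t, ⟨Or.inl ⟨htT, fun h => hv (h.vertex_unique hF htv)⟩, htv⟩, ?_⟩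
    rintro y ⟨hy | hy, hyv⟩
    · exact hu y ⟨hy.1, hyv⟩
    · rw [Set.mem_singleton_iff.1 hy] at hyv
      exact absurd (hx.vertex_unique hF hyv) hv

variable [Fintype H]

open Classical in
/-- The single transitions of the transitions in `T`. -/
noncomputable def singleTransitions (T : Set F.Transition) : Finset (Finset H) :=
  Finset.univ.filter fun s => ∃ t ∈ T, s ∈ t.1

theorem mem_singleTransitions {T : Set F.Transition} {s : Finset H} :
    s ∈ singleTransitions T ↔ ∃ t ∈ T, s ∈ t.1 := by simp [singleTransitions]

section

variable {T : Set F.Transition} (hT : IsTransversal F.skewClasses T)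

include hT

theorem isPairing_singleTransitions : IsPairing (singleTransitions T) := by
  refine ⟨fun s hs => ?_, fun s hs s' hs' hne => ?_⟩
  · obtain ⟨t, -, hst⟩ := mem_singleTransitions.1 hs
    obtain ⟨v, hv⟩ := t.2
    exact hv.1 s hst
  · obtain ⟨t, ht, hst⟩ := mem_singleTransitions.1 hs
    obtain ⟨t', ht', hst'⟩ := mem_singleTransitions.1 hs'
    obtain ⟨v, hv⟩ := t.2
    obtain ⟨v', hv'⟩ := t'.2
    by_cases hvv : v = v'
    · subst hvv
      obtain rfl := (isTransversal_iff.1 hT v).unique ⟨ht, hv⟩ ⟨ht', hv'⟩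
      exact hv.2.1 s hst s' hst' hne
    · rw [Finset.disjoint_left]
      intro a ha ha'
      exact hvv ((mem_star.1 (hv.subset_star hst ha)).2.symm.trans
        (mem_star.1 (hv'.subset_star hst' ha')).2)

theorem biUnion_singleTransitions : (singleTransitions T).biUnion id = F.halfEdges := by
  ext h
  rw [Finset.mem_biUnion]
  constructor
  · rintro ⟨s, hs, hh⟩
    obtain ⟨t, -, hst⟩ := mem_singleTransitions.1 hs
    obtain ⟨v, hv⟩ := t.2
    exact (mem_star.1 (hv.subset_star hst hh)).1
  · intro hh
    obtain ⟨t, ⟨ht, hv⟩, -⟩ := isTransversal_iff.1 hT (F.inc h)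
    have hm : h ∈ F.star (F.inc h) := mem_star.2 ⟨hh, rfl⟩
    exact ⟨_, mem_singleTransitions.2 ⟨t, ht, hv.pair_mate_mem hm⟩, by simp⟩

omit hT in
theorem inc_eq_of_mem_singleTransitions {s : Finset H} (hs : s ∈ singleTransitions T) {a b : H}
    (ha : a ∈ s) (hb : b ∈ s) : F.inc a = F.inc b := by
  obtain ⟨t, -, hst⟩ := mem_singleTransitions.1 hs
  obtain ⟨v, hv⟩ := t.2
  exact (mem_star.1 (hv.subset_star hst ha)).2.trans (mem_star.1 (hv.subset_star hst hb)).2.symm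

end

/-! ### Flows that split at transitions -/

/-- The flows vanishing on `E` that split into flows through the single transitions of `S`. -/
def splitFlows (F : HalfEdgeGraph V H) (E : Finset (Finset H)) (S : Set F.Transition) :
    Submodule ℚ (H → ℚ) where
  carrier := {f | f ∈ F.flows E ∧ ∀ t ∈ S, ∀ s ∈ t.1, ∑ h ∈ s, f h = 0}
  add_mem' := fun {f g} hf hg => ⟨Submodule.add_mem _ hf.1 hg.1, fun t ht s hs => by
    simp only [Pi.add_apply, Finset.sum_add_distrib, hf.2 t ht s hs, hg.2 t ht s hs, add_zero]⟩
  zero_mem' := ⟨Submodule.zero_mem _, by simp⟩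
  smul_mem' := fun c f hf => ⟨Submodule.smul_mem _ _ hf.1, fun t ht s hs => by
    simp only [Pi.smul_apply, ← Finset.smul_sum, hf.2 t ht s hs, smul_zero]⟩

theorem mem_splitFlows {E : Finset (Finset H)} {S : Set F.Transition} {f : H → ℚ} :
    f ∈ F.splitFlows E S ↔ f ∈ F.flows E ∧ ∀ t ∈ S, ∀ s ∈ t.1, ∑ h ∈ s, f h = 0 := Iff.rfl

theorem sum_star {f : H → ℚ} (hf : ∀ h, f (F.opp h) = - f h) (v : V) :
    ∑ h ∈ F.star v, f h = ∑ h with F.inc h = v, f h := by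
  refine Finset.sum_subset (fun h hh => by simp [(mem_star.1 hh).2]) fun h hh hn => ?_
  refine eq_zero_of_skew hf fun hm => hn (mem_star.2 ⟨hm, (Finset.mem_filter.1 hh).2⟩)

/-- The two single transitions of `t` together carry the whole flow at the vertex, which is zero.
This is why the choice made by a transitional orientation does not affect column ranks. -/
theorem forall_sum_eq_zero_iff (hF : F.IsRegular 4) {E : Finset (Finset H)} {f : H → ℚ}
    (hf : f ∈ F.flows E) {t : F.Transition} {s : Finset H} (hs : s ∈ t.1) :
    (∀ s ∈ t.1, ∑ h ∈ s, f h = 0) ↔ ∑ h ∈ s, f h = 0 := by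
  refine ⟨fun h => h s hs, fun h s' hs' => ?_⟩
  obtain ⟨v, hv⟩ := t.2
  rw [hv.eq_pair hF hs] at hs'
  simp only [Finset.mem_insert, Finset.mem_singleton] at hs'
  rcases hs' with rfl | rfl
  · exact h
  · have h1 := Finset.sum_sdiff (f := f) (hv.subset_star hs)
    rw [sum_star hf.1, hf.2.1, h, add_zero] at h1
    exact h1

/-- At a transversal every vertex is split into two pairs, so conservation at the vertices follows
from antisymmetry within the pairs. The flows become the common antisymmetric functions of two
pairings, as in `exists_sign`. -/
theorem mem_splitFlows_empty_iff {T : Set F.Transition} (hT : IsTransversal F.skewClasses T)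
    {f : H → ℚ} : f ∈ F.splitFlows ∅ T ↔
      (∀ h, f (F.opp h) = - f h) ∧ ∀ h, f (mate (singleTransitions T) h) = - f h := by
  have hP := isPairing_singleTransitions hT
  constructor
  · rintro ⟨hf, hs⟩
    refine ⟨hf.1, fun h => ?_⟩
    by_cases hh : h ∈ (singleTransitions T).biUnion id
    · obtain ⟨t, ht, hst⟩ := mem_singleTransitions.1 (hP.pair_mate_mem hh)
      have := hs t ht _ hst
      rw [Finset.sum_pair (hP.mate_ne hh).symm] at this
      linarith
    · rw [mate_of_notMem hh]
      rw [biUnion_singleTransitions hT] at hh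
      rw [eq_zero_of_skew hf.1 hh, neg_zero]
  · rintro ⟨h1, h2⟩
    have key : ∀ t ∈ T, ∀ s ∈ t.1, ∑ h ∈ s, f h = 0 := by
      intro t ht s hs
      have hmem := mem_singleTransitions.2 ⟨t, ht, hs⟩
      obtain ⟨a, ha⟩ : s.Nonempty := by rw [← Finset.card_pos, hP.card s hmem]; norm_num
      rw [hP.eq_pair_mate hmem ha, Finset.sum_pair, h2, add_neg_cancel]
      exact (hP.mate_ne (Finset.mem_biUnion.2 ⟨s, hmem, ha⟩)).symm
    refine ⟨⟨h1, fun v => ?_, by simp⟩, key⟩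
    obtain ⟨t, ⟨ht, hv⟩, -⟩ := isTransversal_iff.1 hT v
    rw [← sum_star h1, ← hv.2.2,
      Finset.sum_biUnion (t := id) fun e he e' he' hne => hv.2.1 e he e' he' hne]
    exact Finset.sum_eq_zero fun s hs => key t ht s hs

/-- The flow of an orientation of the circuits determined by a transversal. -/
theorem exists_sign_mem_splitFlows {T : Set F.Transition} (hT : IsTransversal F.skewClasses T) :
    ∃ g ∈ F.splitFlows ∅ T, ∀ h ∈ F.halfEdges, g h = 1 ∨ g h = -1 := by
  obtain ⟨g, h1, h2, h3⟩ := exists_sign F.isPairing_edges (isPairing_singleTransitions hT)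
    (biUnion_singleTransitions hT).symm
  exact ⟨g, (mem_splitFlows_empty_iff hT).2 ⟨h2, h3⟩, h1⟩

/-- Edges and transitions stay within a component, so a flow can be rescaled on each component
separately. -/
theorem mul_comp_mem_splitFlows {S : Set F.Transition} {f : H → ℚ} (hf : f ∈ F.splitFlows ∅ S)
    (k : F.Component → ℚ) : (fun h => k (F.comp h) * f h) ∈ F.splitFlows ∅ S := by
  refine ⟨⟨fun h => by simp only [comp_opp, hf.1.1]; ring, fun v => ?_, by simp⟩, fun t ht s hs => ?_⟩
  · have : ∀ h ∈ Finset.univ.filter fun h => F.inc h = v,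
        k (F.comp h) * f h = k (Quot.mk _ v) * f h := fun h hh => by
      rw [comp, (Finset.mem_filter.1 hh).2]
    rw [Finset.sum_congr rfl this, ← Finset.mul_sum, hf.1.2.1, mul_zero]
  · obtain ⟨v, hv⟩ := t.2
    have : ∀ h ∈ s, k (F.comp h) * f h = k (Quot.mk _ v) * f h := fun h hh => by
      rw [comp, (mem_star.1 (hv.subset_star hs hh)).2]
    rw [Finset.sum_congr rfl this, ← Finset.mul_sum, hf.2 t ht s hs, mul_zero]

/-! ### Flows violating a transition -/

section

variable {E : Finset (Finset H)} (hE : F.OneEdgePerComponent E)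

include hE

/-- The edge of `E` in the component of `v` carries `±1` in both flows, so a suitable sign makes
them cancel there. Restriction to this component removes all other edges of `E`. -/
theorem OneEdgePerComponent.exists_half_sum {S : Set F.Transition} {g g' : H → ℚ}
    (hg : g ∈ F.splitFlows ∅ S) (hg' : g' ∈ F.splitFlows ∅ S)
    (h1 : ∀ h ∈ F.halfEdges, g h = 1 ∨ g h = -1) (h1' : ∀ h ∈ F.halfEdges, g' h = 1 ∨ g' h = -1)
    (v : V) : ∃ ε : ℚ, (ε = 1 ∨ ε = -1) ∧ ∃ f ∈ F.splitFlows E S, ∀ h ∈ F.star v,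
      f h = (g h + ε * g' h) / 2 := by
  classical
  obtain ⟨e, ⟨he, a, ha, hav⟩, -⟩ := hE.2 (Quot.mk _ v)
  have haF := mem_halfEdges_of_mem (hE.1 he) ha
  obtain ⟨ε, hε, h0⟩ : ∃ ε : ℚ, (ε = 1 ∨ ε = -1) ∧ g a + ε * g' a = 0 := by
    rcases h1 a haF with h | h <;> rcases h1' a haF with h' | h' <;> rw [h, h']
    · exact ⟨-1, by simp, by norm_num⟩
    · exact ⟨1, by simp, by norm_num⟩
    · exact ⟨1, by simp, by norm_num⟩
    · exact ⟨-1, by simp, by norm_num⟩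
  have hf := mul_comp_mem_splitFlows (Submodule.add_mem _ hg (Submodule.smul_mem _ ε hg'))
    fun c => if c = Quot.mk _ v then 1 / 2 else 0
  refine ⟨ε, hε, _, ⟨⟨hf.1.1, hf.1.2.1, fun e' he' h hh => ?_⟩, hf.2⟩, fun h hh => ?_⟩
  · by_cases hc : F.comp h = Quot.mk _ v
    · have hee := hE.eq_of_comp_eq he he' ha hh (hav.trans hc.symm)
      rw [← hee, eq_pair_opp (hE.1 he) ha] at hh
      have hz : (g + ε • g') a = 0 := by simpa using h0
      simp only [Finset.mem_insert, Finset.mem_singleton] at hh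
      rcases hh with rfl | rfl
      · rw [hz, mul_zero]
      · rw [(Submodule.add_mem _ hg (Submodule.smul_mem _ ε hg')).1.1, hz, neg_zero, mul_zero]
    · rw [if_neg hc, zero_mul]
  · have hc : F.comp h = Quot.mk _ v := by rw [comp, (mem_star.1 hh).2]
    change (if F.comp h = Quot.mk _ v then (1 / 2 : ℚ) else 0) * (g h + ε * g' h) = _
    rw [if_pos hc]
    ring

/-- Of two transitions at a vertex that `S` does not meet, at least one is a new constraint. -/
theorem OneEdgePerComponent.exists_mem_splitFlows (hF : F.IsRegular 4) {S T : Set F.Transition}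
    (hT : IsTransversal F.skewClasses T) (hST : S ⊆ T) {v : V}
    (hS : ∀ t ∈ S, ¬ F.IsTransitionAt v t.1) {x y : F.Transition}
    (hx : F.IsTransitionAt v x.1) (hy : F.IsTransitionAt v y.1) (hxy : x ≠ y) :
    ∃ f ∈ F.splitFlows E S,
      (¬ ∀ s ∈ x.1, ∑ h ∈ s, f h = 0) ∨ ¬ ∀ s ∈ y.1, ∑ h ∈ s, f h = 0 := by
  obtain ⟨a, b, c, d, hstar, hab, hac, had, hbc, hbd, hcd, x1, x2, y1, y2, z, hz, z1, z2⟩ :=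
    exists_star_eq hF hx hy fun h => hxy (Subtype.ext h)
  -- Choosing `t` at `v` in place of the element of `T` gives another transversal, whose circuits
  -- are oriented. It still contains `S`, which does not meet the class of `v`.
  have sign : ∀ t : F.Transition, F.IsTransitionAt v t.1 → ∃ g ∈ F.splitFlows ∅ S,
      (∀ h ∈ F.halfEdges, g h = 1 ∨ g h = -1) ∧ ∀ s ∈ t.1, ∑ h ∈ s, g h = 0 := by
    intro t ht
    obtain ⟨g, hg, h1⟩ := exists_sign_mem_splitFlows (IsTransversal.update hF hT ht)
    exact ⟨g, ⟨hg.1, fun t' ht' => hg.2 t' (Or.inl ⟨hST ht', hS t' ht'⟩)⟩, h1,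
      hg.2 t (Or.inr rfl)⟩
  obtain ⟨gx, hgx, hx1, hx0⟩ := sign x hx
  obtain ⟨gy, hgy, hy1, hy0⟩ := sign y hy
  obtain ⟨gz, hgz, hz1, hz0⟩ := sign ⟨z, v, hz⟩ hz
  have ma : a ∈ F.star v := by simp [hstar]
  have mb : b ∈ F.star v := by simp [hstar]
  have mc : c ∈ F.star v := by simp [hstar]
  have md : d ∈ F.star v := by simp [hstar]
  have gx1 := hx0 _ x1
  have gx2 := hx0 _ x2
  have gy1 := hy0 _ y1
  have gy2 := hy0 _ y2
  have gz1 := hz0 _ z1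
  have gz2 := hz0 _ z2
  rw [Finset.sum_pair ‹_›] at gx1 gx2 gy1 gy2 gz1 gz2
  -- If `gx` agrees at `a` and `c`, then adding `± gy`, which cancels over `{a, c}`, leaves a
  -- nonzero amount over this single transition of `y`.
  by_cases hcase : gx c = gx a
  · obtain ⟨ε, hε, f, hf, hfv⟩ := hE.exists_half_sum hgx hgy hx1 hy1 v
    refine ⟨f, hf, Or.inr fun h0 => ?_⟩
    have := h0 _ y1
    rw [Finset.sum_pair hac, hfv a ma, hfv c mc] at this
    have h3 : gx a = 0 := by
      have : ε * (gy a + gy c) = 0 := by rw [gy1, mul_zero]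
      linarith
    rcases hx1 a (mem_star.1 ma).1 with h | h <;> rw [h] at h3 <;> norm_num at h3
  -- Now `gx` cancels over both `{a, b}` and `{a, c}`. If `gz` did so too, it would have the same
  -- nonzero value at `b` and `c`, which form a single transition of `z`.
  · obtain ⟨ε, hε, f, hf, hfv⟩ := hE.exists_half_sum hgx hgz hx1 hz1 v
    refine ⟨f, hf, ?_⟩
    by_contra! hcon
    have e1 := hcon.1 _ x1
    have e2 := hcon.2 _ y1
    rw [Finset.sum_pair hab, hfv a ma, hfv b mb] at e1
    rw [Finset.sum_pair hac, hfv a ma, hfv c mc] at e2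
    have hgac : gx a + gx c = 0 := by
      rcases hx1 a (mem_star.1 ma).1 with h | h <;> rcases hx1 c (mem_star.1 mc).1 with h' | h' <;>
        rw [h, h'] at hcase ⊢ <;> first | exact absurd rfl hcase | norm_num
    have h3 : ε * (gz a + gz b) = 0 := by linarith
    have h4 : ε * (gz a + gz c) = 0 := by linarith
    have hε0 : ε ≠ 0 := by rcases hε with h | h <;> rw [h] <;> norm_num
    have h5 := (mul_eq_zero.1 h3).resolve_left hε0
    have h6 := (mul_eq_zero.1 h4).resolve_left hε0
    have h7 : gz a = 0 := by linarith
    rcases hz1 a (mem_star.1 ma).1 with h | h <;> rw [h] at h7 <;> norm_num at h7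

end

end HalfEdgeGraph

/-! ### Dimensions of flow spaces -/

namespace HalfEdgeGraph

variable {V H : Type*} {F : HalfEdgeGraph V H}

theorem nonempty_directedVersion (F : HalfEdgeGraph V H) [DecidableEq H] :
    Nonempty F.DirectedVersion := by
  have h : ∀ e : F.edges, ∃ p : H × H, {p.1, p.2} = e.1 := fun e => by
    obtain ⟨a, b, -, h⟩ := Finset.card_eq_two.1 (F.card_edge e.1 e.2)
    exact ⟨(a, b), h.symm⟩
  choose p hp using h
  exact ⟨⟨fun e => (p e).1, fun e => (p e).2, hp⟩⟩

variable [DecidableEq H]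

theorem DirectedVersion.head_mem (D : F.DirectedVersion) (e : F.edges) : D.head e ∈ e.1 := by
  rw [← D.tail_head]; simp

theorem DirectedVersion.tail_mem (D : F.DirectedVersion) (e : F.edges) : D.tail e ∈ e.1 := by
  rw [← D.tail_head]; simp

/-- A function on the edges, as an antisymmetric function on the half-edges. -/
noncomputable def skewExtend (D : F.DirectedVersion) (z : F.edges → ℚ) (h : H) : ℚ :=
  ∑ e : F.edges, ((if h = D.tail e then z e else 0) - if h = D.head e then z e else 0)

theorem skewExtend_tail (D : F.DirectedVersion) (z : F.edges → ℚ) (e : F.edges) :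
    skewExtend D z (D.tail e) = z e := by
  rw [skewExtend, Finset.sum_eq_single e]
  · simp [D.tail_ne_head]
  · intro e' _ hne
    have key : ∀ h' ∈ e'.1, D.tail e ≠ h' := fun h' hh' h => hne
      (Subtype.ext (F.isPairing_edges.eq_of_mem e'.2 e.2 hh' (h ▸ D.tail_mem e)))
    rw [if_neg (key _ (D.tail_mem e')), if_neg (key _ (D.head_mem e')), sub_zero]
  · simp

theorem skewExtend_opp (D : F.DirectedVersion) (z : F.edges → ℚ) (h : H) :
    skewExtend D z (F.opp h) = - skewExtend D z h := by
  rw [skewExtend, skewExtend, ← Finset.sum_neg_distrib]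
  refine Finset.sum_congr rfl fun e _ => ?_
  have h1 : F.opp h = D.tail e ↔ h = D.head e := by
    rw [← D.opp_tail]
    exact ⟨fun h1 => by rw [← h1, opp_opp], fun h1 => by rw [h1, opp_opp]⟩
  have h2 : F.opp h = D.head e ↔ h = D.tail e := by
    rw [← D.opp_tail]
    exact ⟨fun h1 => opp_injective h1, fun h1 => by rw [h1]⟩
  simp only [h1, h2]
  ring

theorem eq_skewExtend (D : F.DirectedVersion) {f : H → ℚ} (hf : ∀ h, f (F.opp h) = - f h) :
    f = skewExtend D fun e => f (D.tail e) := by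
  ext h
  by_cases hh : h ∈ F.halfEdges
  · obtain ⟨e, he, hhe⟩ := Finset.mem_biUnion.1 hh
    have h2 : e = {D.tail ⟨e, he⟩, D.head ⟨e, he⟩} := (D.tail_head ⟨e, he⟩).symm
    rw [id, h2, Finset.mem_insert, Finset.mem_singleton] at hhe
    rcases hhe with h3 | h3
    · rw [h3, skewExtend_tail]
    · rw [h3, ← D.opp_tail, skewExtend_opp, skewExtend_tail, hf]
  · rw [eq_zero_of_skew hf hh, eq_zero_of_skew (skewExtend_opp D _) hh]

variable [DecidableEq V]

theorem card_edges [Fintype V] (hF : F.IsRegular 4) : F.edges.card = 2 * Fintype.card V := by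
  have h1 : F.halfEdges.card = ∑ e ∈ F.edges, 2 := by
    rw [halfEdges, Finset.card_biUnion (t := id)
      fun e he e' he' hne => F.disjoint_edges e he e' he' hne]
    exact Finset.sum_congr rfl F.card_edge
  have h2 : F.halfEdges.card = ∑ v : V, 4 := by
    rw [Finset.card_eq_sum_card_fiberwise (f := F.inc) (t := Finset.univ) fun _ _ => by simp]
    exact Finset.sum_congr rfl fun v _ => hF v
  simp only [Finset.sum_const, smul_eq_mul, Finset.card_univ] at h1 h2
  omega

/-- The vertex-edge incidence matrix. -/
def incidenceMatrix (D : F.DirectedVersion) : Matrix V F.edges ℚ :=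
  Matrix.of fun v e => (if F.inc (D.tail e) = v then 1 else 0) -
    (if F.inc (D.head e) = v then 1 else 0)

/-- The kernel consists of the potentials that agree at the two ends of every edge, which are the
functions on the components. -/
theorem finrank_ker_transpose [Fintype V] (D : F.DirectedVersion) :
    Module.finrank ℚ (LinearMap.ker (incidenceMatrix D).transpose.mulVecLin) =
      F.numComponents := by
  classical
  have : Finite F.Component := Quot.finite F.Adj
  have := Fintype.ofFinite F.Component
  have hmul : ∀ y : V → ℚ, ∀ e, (incidenceMatrix D).transpose.mulVecLin y e =
      y (F.inc (D.tail e)) - y (F.inc (D.head e)) := fun y e => by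
    simp [Matrix.vecMul, dotProduct, incidenceMatrix, mul_sub, Finset.sum_sub_distrib]
  have hconst : ∀ y ∈ LinearMap.ker (incidenceMatrix D).transpose.mulVecLin, ∀ u v,
      F.Adj u v → y u = y v := by
    rintro y hy u v ⟨e, he, h, hh, h', hh', rfl, rfl⟩
    have h1 := hmul y ⟨e, he⟩
    rw [LinearMap.mem_ker.1 hy, Pi.zero_apply] at h1
    have h2 : e = {D.tail ⟨e, he⟩, D.head ⟨e, he⟩} := (D.tail_head ⟨e, he⟩).symm
    rw [h2, Finset.mem_insert, Finset.mem_singleton] at hh hh'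
    rcases hh with h3 | h3 <;> rcases hh' with h4 | h4 <;> rw [h3, h4] <;> linarith
  let φ : LinearMap.ker (incidenceMatrix D).transpose.mulVecLin ≃ₗ[ℚ] (F.Component → ℚ) :=
    { toFun := fun y => Quot.lift y.1 (hconst y.1 y.2)
      map_add' := fun y z => by ext ⟨v⟩; rfl
      map_smul' := fun c y => by ext ⟨v⟩; rfl
      invFun := fun k => ⟨fun v => k (Quot.mk _ v), by
        rw [LinearMap.mem_ker]
        ext e
        rw [hmul, Pi.zero_apply, sub_eq_zero]
        congr 1
        exact Quot.sound ⟨e.1, e.2, _, by rw [← D.tail_head]; simp, _,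
          by rw [← D.tail_head]; simp, rfl, rfl⟩⟩
      left_inv := fun y => rfl
      right_inv := fun k => by ext ⟨v⟩; rfl }
  rw [φ.finrank_eq, Module.finrank_fintype_fun_eq_card, numComponents, Nat.card_eq_fintype_card]

variable [Fintype H]

theorem sum_skewExtend (D : F.DirectedVersion) (z : F.edges → ℚ) (v : V) :
    ∑ h with F.inc h = v, skewExtend D z h = (incidenceMatrix D).mulVec z v := by
  simp only [skewExtend, Matrix.mulVec, dotProduct, incidenceMatrix, Matrix.of_apply]
  rw [Finset.sum_comm]
  refine Finset.sum_congr rfl fun e _ => ?_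
  rw [Finset.sum_sub_distrib]
  simp [Finset.mem_filter, sub_mul]

/-- The combination of rows with coefficients `c` has at `t` the value of the flow with coordinates
`c` summed over `o t`. Hence the combinations vanishing on `S` correspond to the flows that split
along `S`, and rank-nullity applies. -/
theorem IsFlowBasis.finrank_span {E : Finset (Finset H)} (hF : F.IsRegular 4)
    {B : Type*} [Fintype B] {w : B → H → ℚ} {a : B → H} (hw : F.IsFlowBasis E w a)
    (o : F.TransitionalOrientation) (A : Matrix B F.Transition ℚ)
    (hA : ∀ b t, A b t = ∑ h ∈ o.1 t, w b h) (S : Set F.Transition) :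
    Module.finrank ℚ (Submodule.span ℚ (A.col '' S)) + Module.finrank ℚ (F.splitFlows E S) =
      Fintype.card B := by
  let L : (B → ℚ) →ₗ[ℚ] (H → ℚ) := (F.flows E).subtype ∘ₗ hw.equiv.toLinearMap
  have hinj : Function.Injective L :=
    (Submodule.subtype_injective _).comp hw.equiv.injective
  have hrange : F.splitFlows E S ≤ LinearMap.range L := fun f hf =>
    ⟨hw.equiv.symm ⟨f, hf.1⟩, by simp [L]⟩
  have h1 := (Submodule.equivMapOfInjective L hinj ((F.splitFlows E S).comap L)).finrank_eq
  rw [Submodule.map_comap_eq_of_le hrange] at h1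
  rw [← h1]
  refine finrank_span_col_add_finrank A S _ fun c => ?_
  have hLc : L c ∈ F.flows E := (hw.equiv c).2
  have hsum : ∀ t, ∑ b, c b * A b t = ∑ h ∈ o.1 t, L c h := fun t => by
    simp only [hA, Finset.mul_sum]
    rw [Finset.sum_comm]
    rfl
  rw [Submodule.mem_comap, mem_splitFlows]
  simp only [hsum, hLc, true_and]
  exact forall₂_congr fun t _ => forall_sum_eq_zero_iff hF hLc (o.2 t)

variable [Fintype V]

/-- Flows are the kernel of the incidence matrix, which has `2 * |V|` columns and rank `|V| - c(F)`.
-/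
theorem finrank_flows_empty (hF : F.IsRegular 4) :
    Module.finrank ℚ (F.flows ∅) = Fintype.card V + F.numComponents := by
  obtain ⟨D⟩ := F.nonempty_directedVersion
  let φ : LinearMap.ker (incidenceMatrix D).mulVecLin ≃ₗ[ℚ] F.flows ∅ :=
    { toFun := fun z => ⟨skewExtend D z.1, skewExtend_opp D z.1, fun v => by
        rw [sum_skewExtend]
        exact congrFun (LinearMap.mem_ker.1 z.2) v, by simp⟩
      map_add' := fun z z' => by
        ext h
        simp only [skewExtend, Submodule.coe_add, Pi.add_apply, ← Finset.sum_add_distrib]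
        exact Finset.sum_congr rfl fun e _ => by split_ifs <;> ring
      map_smul' := fun c z => by
        ext h
        simp only [skewExtend, Submodule.coe_smul, Pi.smul_apply, smul_eq_mul, Finset.mul_sum,
          RingHom.id_apply]
        exact Finset.sum_congr rfl fun e _ => by split_ifs <;> ring
      invFun := fun f => ⟨fun e => f.1 (D.tail e), by
        rw [LinearMap.mem_ker]
        ext v
        rw [Matrix.mulVecLin_apply, ← sum_skewExtend, ← eq_skewExtend D f.2.1]
        exact f.2.2.1 v⟩
      left_inv := fun z => by ext e; exact skewExtend_tail D z.1 e
      right_inv := fun f => by ext h; exact (congrFun (eq_skewExtend D f.2.1) h).symm }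
  have h1 := LinearMap.finrank_range_add_finrank_ker (incidenceMatrix D).mulVecLin
  have h2 := LinearMap.finrank_range_add_finrank_ker (incidenceMatrix D).transpose.mulVecLin
  have h3 : (incidenceMatrix D).transpose.rank = (incidenceMatrix D).rank :=
    Matrix.rank_transpose _
  rw [finrank_ker_transpose] at h2
  rw [Matrix.rank, Matrix.rank] at h3
  rw [φ.finrank_eq, Module.finrank_fintype_fun_eq_card, Fintype.card_coe, card_edges hF] at h1
  rw [Module.finrank_fintype_fun_eq_card] at h2
  omega

/-- Evaluation at one half-edge of each edge in `E` has kernel `flows E`. It is onto, since a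
`±1`-flow can be rescaled on each component; so exactly `c(F)` dimensions are lost. -/
theorem finrank_flows (hF : F.IsRegular 4) {E : Finset (Finset H)}
    (hE : F.OneEdgePerComponent E) : Module.finrank ℚ (F.flows E) = Fintype.card V := by
  classical
  have : Finite F.Component := Quot.finite F.Adj
  have := Fintype.ofFinite F.Component
  choose e he hu using hE.2
  choose heE a ha hac using he
  let ψ : F.flows ∅ →ₗ[ℚ] (F.Component → ℚ) :=
    { toFun := fun f c => f.1 (a c)
      map_add' := fun _ _ => rfl
      map_smul' := fun _ _ => rfl }
  have hsurj : LinearMap.range ψ = ⊤ := by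
    rw [LinearMap.range_eq_top]
    intro k
    obtain ⟨T, hT⟩ := exists_isTransversal hF
    obtain ⟨g, hg, h1⟩ := exists_sign_mem_splitFlows hT
    -- The factor `g (a c)` cancels the sign of `g` at `a c`.
    refine ⟨⟨_, (mul_comp_mem_splitFlows hg fun c => k c * g (a c)).1⟩, ?_⟩
    ext c
    change k (F.comp (a c)) * g (a (F.comp (a c))) * g (a c) = k c
    have hc : F.comp (a c) = c := hac c
    rw [hc]
    rcases h1 (a c) (mem_halfEdges_of_mem (hE.1 (heE c)) (ha c)) with h | h <;> rw [h] <;> ring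
  have hker : Module.finrank ℚ (LinearMap.ker ψ) = Module.finrank ℚ (F.flows E) := by
    refine LinearEquiv.finrank_eq
      { toFun := fun f => ⟨f.1.1, f.1.2.1, f.1.2.2.1, fun e' he' h hh => ?_⟩
        map_add' := fun _ _ => rfl
        map_smul' := fun _ _ => rfl
        invFun := fun f => ⟨⟨f.1, f.2.1, f.2.2.1, by simp⟩, ?_⟩
        left_inv := fun _ => rfl
        right_inv := fun _ => rfl }
    · have h1 : ∀ c, f.1.1 (a c) = 0 := fun c => congrFun (LinearMap.mem_ker.1 f.2) c
      have hee : e (F.comp h) = e' := hE.eq_of_comp_eq (heE _) he' (ha _) hh (hac _)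
      rw [← hee, eq_pair_opp (hE.1 (heE _)) (ha _)] at hh
      simp only [Finset.mem_insert, Finset.mem_singleton] at hh
      generalize F.comp h = c at hh
      rcases hh with rfl | rfl
      · exact h1 _
      · rw [f.1.2.1, h1, neg_zero]
    · rw [LinearMap.mem_ker]
      ext c
      exact f.2.2.2 _ (heE c) _ (ha c)
  have h1 := LinearMap.finrank_range_add_finrank_ker ψ
  rw [hsurj, finrank_top, hker, finrank_flows_empty hF, Module.finrank_fintype_fun_eq_card,
    numComponents, Nat.card_eq_fintype_card] at h1
  omega

end HalfEdgeGraph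

namespace HalfEdgeGraph

variable {V H : Type*} [DecidableEq H] {F : HalfEdgeGraph V H}

/-! ### Circuit partitions -/

theorem mem_toCircuit {W : Cycle (H × H)} {s : Finset H} :
    s ∈ toCircuit W ↔ ∃ p ∈ W, {p.1, p.2} = s := by
  simp [toCircuit, mem_toMultiset]

theorem exists_mem_toCircuit {W : Cycle (H × H)} {h : H} :
    (∃ s ∈ toCircuit W, h ∈ s) ↔ ∃ p ∈ W, h = p.1 ∨ h = p.2 := by
  simp only [mem_toCircuit]
  constructor
  · rintro ⟨_, ⟨p, hp, rfl⟩, hh⟩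
    exact ⟨p, hp, by simpa using hh⟩
  · rintro ⟨p, hp, hh⟩
    exact ⟨_, ⟨p, hp, rfl⟩, by simpa using hh⟩

theorem IsCircuit.opp_mem {C : Finset (Finset H)} (hC : F.IsCircuit C) {h : H}
    (hh : ∃ s ∈ C, h ∈ s) : ∃ s ∈ C, F.opp h ∈ s := by
  obtain ⟨W, hW, rfl⟩ := hC
  rw [exists_mem_toCircuit] at hh ⊢
  obtain ⟨p, hp, rfl | rfl⟩ := hh
  · obtain ⟨q, hq, h⟩ := hW.1.exists_snd_eq_opp hp
    exact ⟨q, hq, Or.inr h.symm⟩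
  · obtain ⟨q, hq, h⟩ := hW.1.exists_fst_eq_opp hp
    exact ⟨q, hq, Or.inl h.symm⟩

theorem IsCircuit.mem_halfEdges {C : Finset (Finset H)} (hC : F.IsCircuit C) {h : H}
    (hh : ∃ s ∈ C, h ∈ s) : h ∈ F.halfEdges := by
  obtain ⟨W, hW, rfl⟩ := hC
  obtain ⟨p, hp, rfl | rfl⟩ := exists_mem_toCircuit.1 hh
  · exact hW.1.fst_mem hp
  · exact hW.1.snd_mem hp

theorem IsCircuit.exists_mem {C : Finset (Finset H)} (hC : F.IsCircuit C) :
    ∃ h, ∃ s ∈ C, h ∈ s := by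
  obtain ⟨W, hW, rfl⟩ := hC
  have hne : W.toMultiset ≠ 0 := fun h => hW.2.1 (Cycle.toMultiset_eq_nil.1 h)
  obtain ⟨p, hp⟩ := Multiset.exists_mem_of_ne_zero hne
  exact ⟨p.1, exists_mem_toCircuit.2 ⟨p, mem_toMultiset.1 hp, Or.inl rfl⟩⟩

variable [DecidableEq V] [Fintype H]

section

variable {T : Set F.Transition} (hT : IsTransversal F.skewClasses T)
  {P : Finset (Finset (Finset H))} (hP : F.IsCircuitPartition P) (hPT : F.tau P = T)

include hT hP hPT

/-- As `τ(P) = T`, the pair lies in some circuit of `P`, and only one circuit contains `h`. -/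
theorem IsCircuitPartition.pair_mem {C : Finset (Finset H)} (hC : C ∈ P) {h : H}
    (hh : ∃ s ∈ C, h ∈ s) : {h, mate (singleTransitions T) h} ∈ C := by
  have hhF := (hP.1 C hC).mem_halfEdges hh
  have hmem := (isPairing_singleTransitions hT).pair_mate_mem (h := h)
    (by rwa [biUnion_singleTransitions hT])
  obtain ⟨t, ht, hst⟩ := mem_singleTransitions.1 hmem
  rw [← hPT] at ht
  obtain ⟨C', hC', hs⟩ := ht _ hst
  rwa [(hP.2 h hhF).unique ⟨hC, hh⟩ ⟨hC', _, hs, by simp⟩]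

/-- A quantity preserved along edges and transitions is constant on the circuits. -/
theorem IsCircuitPartition.apply_eq {X : Type*} {k : H → X} (hk : ∀ h, k (F.opp h) = k h)
    (hk' : ∀ h ∈ F.halfEdges, k (mate (singleTransitions T) h) = k h)
    {C : Finset (Finset H)} (hC : C ∈ P) {h h' : H}
    (hh : ∃ s ∈ C, h ∈ s) (hh' : ∃ s ∈ C, h' ∈ s) : k h = k h' := by
  have hCir := hP.1 C hC
  obtain ⟨W, hW, hCW⟩ := hCir
  have hstep : ∀ p ∈ W, k p.1 = k p.2 := by
    intro p hp
    have hpC : ∃ s ∈ C, p.1 ∈ s := hCW ▸ exists_mem_toCircuit.2 ⟨p, hp, Or.inl rfl⟩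
    have hm := IsCircuitPartition.pair_mem hT hP hPT hC hpC
    have hm' := hm
    rw [hCW, mem_toCircuit] at hm'
    obtain ⟨q, hq, hqe⟩ := hm'
    have h1 : p.1 ∈ ({q.1, q.2} : Finset H) := hqe ▸ (by simp)
    simp only [Finset.mem_insert, Finset.mem_singleton] at h1
    have h2 : p.1 = q.1 := h1.resolve_right (hW.fst_ne_snd hp hq)
    obtain rfl := Multiset.inj_on_of_nodup_map hW.nodup_fst p (mem_toMultiset.2 hp) q
      (mem_toMultiset.2 hq) h2
    have h3 : p.2 ∈ ({p.1, mate (singleTransitions T) p.1} : Finset H) := hqe ▸ (by simp)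
    simp only [Finset.mem_insert, Finset.mem_singleton] at h3
    rw [h3.resolve_left (hW.fst_ne_snd hp hp).symm, hk' _ (hW.1.fst_mem hp)]
  rw [hCW, exists_mem_toCircuit] at hh hh'
  obtain ⟨p, hp, hph⟩ := hh
  obtain ⟨q, hq, hqh⟩ := hh'
  have h1 : k h = k p.1 := by rcases hph with rfl | rfl; exacts [rfl, (hstep p hp).symm]
  have h2 : k h' = k q.1 := by rcases hqh with rfl | rfl; exacts [rfl, (hstep q hq).symm]
  rw [h1, h2]
  exact hW.1.forall_eq hstep (fun h _ => hk h) hp hq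

/-- Relative to a `±1`-flow `g` orienting the circuits, a flow splitting along `T` is one constant
for each circuit. Vanishing on `E` forces zero on the circuits through edges of `E`. There are
`c(F)` of these, because a circuit stays within a component. -/
theorem IsCircuitPartition.finrank_splitFlows [Finite V] {E : Finset (Finset H)}
    (hE : F.OneEdgePerComponent E) :
    Module.finrank ℚ (F.splitFlows E T) + F.numComponents = P.card := by
  classical
  have : Finite F.Component := Quot.finite F.Adj
  have := Fintype.ofFinite F.Component
  have hpair := isPairing_singleTransitions hT
  have hU := biUnion_singleTransitions hT
  set σ := mate (singleTransitions T) with hσ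
  -- `κ h` is the circuit of `P` through `h`, with the dummy value `∅` if `h` lies on no edge.
  have hκ : ∀ h : H, ∃ C, h ∈ F.halfEdges → C ∈ P ∧ ∃ s ∈ C, h ∈ s := fun h => by
    by_cases hh : h ∈ F.halfEdges
    · exact ⟨_, fun _ => (hP.2 h hh).exists.choose_spec⟩
    · exact ⟨∅, fun h => absurd h hh⟩
  choose κ hκ using hκ
  have κ_eq : ∀ {h C}, C ∈ P → (∃ s ∈ C, h ∈ s) → κ h = C := fun {h C} hC hh => by
    have hhF := (hP.1 C hC).mem_halfEdges hh
    exact (hP.2 h hhF).unique (hκ h hhF) ⟨hC, hh⟩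
  have κ_opp : ∀ h ∈ F.halfEdges, κ (F.opp h) = κ h := fun h hh =>
    κ_eq (hκ h hh).1 ((hP.1 _ (hκ h hh).1).opp_mem (hκ h hh).2)
  have κ_σ : ∀ h ∈ F.halfEdges, κ (σ h) = κ h := fun h hh =>
    κ_eq (hκ h hh).1 ⟨_, IsCircuitPartition.pair_mem hT hP hPT (hκ h hh).1 (hκ h hh).2,
      by simp [hσ]⟩
  choose e he hu using hE.2
  choose heE a ha hac using he
  have haF : ∀ c, a c ∈ F.halfEdges := fun c => mem_halfEdges_of_mem (hE.1 (heE c)) (ha c)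
  have hinj : Function.Injective fun c => κ (a c) := fun c c' h => by
    have h : κ (a c) = κ (a c') := h
    have hcomp : ∀ h ∈ F.halfEdges, F.inc (σ h) = F.inc h := fun h hh =>
      inc_eq_of_mem_singleTransitions (hpair.pair_mate_mem (by rwa [hU])) (by simp [hσ]) (by simp)
    have := IsCircuitPartition.apply_eq hT hP hPT (k := F.comp) comp_opp
      (fun h hh => congrArg (Quot.mk F.Adj) (hcomp h hh)) (hκ _ (haF c)).1 (hκ _ (haF c)).2
      (h ▸ (hκ _ (haF c')).2)
    exact (hac c).symm.trans (this.trans (hac c'))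
  set P₀ : Finset (Finset (Finset H)) := Finset.univ.image fun c => κ (a c) with hP₀
  have hP₀P : P₀ ⊆ P := by
    intro C hC
    obtain ⟨c, -, rfl⟩ := Finset.mem_image.1 hC
    exact (hκ _ (haF c)).1
  have hcard : (P \ P₀).card + F.numComponents = P.card := by
    rw [numComponents, Nat.card_eq_fintype_card, ← Finset.card_univ,
      ← Finset.card_image_of_injective _ hinj, Finset.card_sdiff_add_card_eq_card hP₀P]
  obtain ⟨g, hg, h1⟩ := exists_sign_mem_splitFlows hT
  rw [mem_splitFlows_empty_iff hT] at hg
  have hsq : ∀ h ∈ F.halfEdges, g h * g h = 1 := fun h hh => by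
    rcases h1 h hh with h | h <;> rw [h] <;> norm_num
  let ext : (↥(P \ P₀) → ℚ) → Finset (Finset H) → ℚ :=
    fun y C => if hC : C ∈ P \ P₀ then y ⟨C, hC⟩ else 0
  let Φ : (↥(P \ P₀) → ℚ) →ₗ[ℚ] (H → ℚ) :=
    { toFun := fun y h => g h * ext y (κ h)
      map_add' := fun y z => by
        ext h
        simp only [ext, Pi.add_apply]
        split_ifs <;> ring
      map_smul' := fun c y => by
        ext h
        simp only [ext, Pi.smul_apply, smul_eq_mul, RingHom.id_apply]
        split_ifs <;> ring }
  have hΦ : ∀ y h, Φ y h = g h * ext y (κ h) := fun _ _ => rfl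
  have hΦinj : Function.Injective Φ := by
    rw [← LinearMap.ker_eq_bot, Submodule.eq_bot_iff]
    intro y hy
    ext ⟨C, hC⟩
    have hCP := (Finset.mem_sdiff.1 hC).1
    obtain ⟨h, hh⟩ := (hP.1 C hCP).exists_mem
    have h2 : Φ y h = 0 := congrFun (LinearMap.mem_ker.1 hy) h
    rw [hΦ, κ_eq hCP hh] at h2
    have hne : g h ≠ 0 := fun h0 => by
      have := hsq h ((hP.1 C hCP).mem_halfEdges hh)
      rw [h0] at this
      norm_num at this
    have h3 := (mul_eq_zero.1 h2).resolve_left hne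
    simpa only [ext, dif_pos hC, Pi.zero_apply] using h3
  have hrange : LinearMap.range Φ = F.splitFlows E T := by
    ext f
    constructor
    · rintro ⟨y, rfl⟩
      have hskew : ∀ {ν : H → H}, (∀ h, g (ν h) = - g h) → (∀ h ∈ F.halfEdges, κ (ν h) = κ h) →
          ∀ h, Φ y (ν h) = - Φ y h := by
        intro ν hν hν' h
        rw [hΦ, hΦ, hν]
        by_cases hh : h ∈ F.halfEdges
        · rw [hν' h hh]; ring
        · rw [eq_zero_of_skew hg.1 hh]; ring
      have hmem := (mem_splitFlows_empty_iff hT).2 ⟨hskew hg.1 κ_opp, hskew hg.2 κ_σ⟩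
      refine ⟨⟨hmem.1.1, hmem.1.2.1, fun e' he' h hh => ?_⟩, hmem.2⟩
      have hee : e (F.comp h) = e' := hE.eq_of_comp_eq (heE _) he' (ha _) hh (hac _)
      have hκh : κ h ∈ P₀ := by
        refine Finset.mem_image.2 ⟨F.comp h, Finset.mem_univ _, ?_⟩
        rw [← hee, eq_pair_opp (hE.1 (heE _)) (ha _)] at hh
        simp only [Finset.mem_insert, Finset.mem_singleton] at hh
        rcases hh with h2 | h2
        · rw [← h2]
        · exact (κ_opp _ (haF _)).symm.trans (congrArg κ h2.symm)
      have : κ h ∉ P \ P₀ := fun h2 => (Finset.mem_sdiff.1 h2).2 hκh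
      rw [hΦ]
      simp only [ext, dif_neg this, mul_zero]
    · intro hf
      have hf' := (mem_splitFlows_empty_iff hT).1
        ⟨flows_mono (Finset.empty_subset E) hf.1, hf.2⟩
      -- Both `f` and `g` change sign along edges and transitions, so their product is constant on
      -- each circuit.
      have hk : ∀ {h h'}, h ∈ F.halfEdges → h' ∈ F.halfEdges → κ h = κ h' →
          f h * g h = f h' * g h' := fun {h h'} hh hh' he =>
        IsCircuitPartition.apply_eq hT hP hPT (k := fun h => f h * g h)
          (fun h => by simp only [hf'.1, hg.1]; ring)
          (fun h _ => by simp only [hf'.2]; rw [hg.2]; ring)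
          (hκ h hh).1 (hκ h hh).2 (he ▸ (hκ h' hh').2)
      have hx : ∀ C : ↥(P \ P₀), ∃ h, ∃ s ∈ C.1, h ∈ s := fun C =>
        (hP.1 C.1 (Finset.mem_sdiff.1 C.2).1).exists_mem
      choose x hx using hx
      refine ⟨fun C => f (x C) * g (x C), ?_⟩
      ext h
      rw [hΦ]
      by_cases hh : h ∈ F.halfEdges
      · by_cases hC : κ h ∈ P \ P₀
        · have hxF := (hP.1 _ (Finset.mem_sdiff.1 hC).1).mem_halfEdges (hx ⟨_, hC⟩)
          have h2 : f h * g h = f (x ⟨_, hC⟩) * g (x ⟨_, hC⟩) :=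
            hk hh hxF (κ_eq (Finset.mem_sdiff.1 hC).1 (hx ⟨_, hC⟩)).symm
          simp only [ext, dif_pos hC, ← h2]
          linear_combination f h * hsq h hh
        · have hC0 : κ h ∈ P₀ := by
            by_contra hn
            exact hC (Finset.mem_sdiff.2 ⟨(hκ h hh).1, hn⟩)
          obtain ⟨c, -, hc⟩ := Finset.mem_image.1 hC0
          have h2 : f h * g h = f (a c) * g (a c) := hk hh (haF c) hc.symm
          rw [hf.1.2.2 _ (heE c) _ (ha c), zero_mul] at h2
          simp only [ext, dif_neg hC, mul_zero]
          linear_combination f h * hsq h hh - g h * h2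
      · rw [eq_zero_of_skew hg.1 hh, eq_zero_of_skew hf.1.1 hh, zero_mul]
  rw [← hcard, ← hrange, LinearMap.finrank_range_of_inj hΦinj,
    Module.finrank_fintype_fun_eq_card, Fintype.card_coe]

end

/-- Every transversal is induced by a circuit partition. -/
theorem exists_isCircuitPartition (hF : F.IsRegular 4) {T : Set F.Transition}
    (hT : IsTransversal F.skewClasses T) : ∃ P, F.IsCircuitPartition P ∧ F.tau P = T := by
  classical
  have hpair := isPairing_singleTransitions hT
  have hU := biUnion_singleTransitions hT
  obtain ⟨g, hg, h1⟩ := exists_sign_mem_splitFlows hT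
  rw [mem_splitFlows_empty_iff hT] at hg
  set σ := mate (singleTransitions T) with hσ
  have hσF : ∀ h, σ h ∈ F.halfEdges ↔ h ∈ F.halfEdges := fun h => by
    rw [← hU]; exact hpair.mate_mem_iff
  -- Having left a vertex by `z`, arrive by `F.opp z` and leave by its partner. Each circuit is an
  -- orbit of `n` in either direction; restricting to `Q`, where `g = 1`, selects one direction.
  let n : H → H := fun z => σ (F.opp z)
  have hninj : Function.Injective n := hpair.mate_injective.comp opp_injective
  have hper : ∀ z, z ∈ Function.periodicPts n := fun z => hninj.mem_periodicPts z
  let Q : Set H := {h | h ∈ F.halfEdges ∧ g h = 1}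
  have hnQ : ∀ z ∈ Q, n z ∈ Q := fun z hz =>
    ⟨(hσF _).2 (opp_mem_iff.2 hz.1), by
      change g (σ (F.opp z)) = 1
      rw [hg.2, hg.1, hz.2, neg_neg]⟩
  have hiter : ∀ x ∈ Q, ∀ k, n^[k] x ∈ Q := fun x hx k => by
    induction k with
    | zero => exact hx
    | succ k ih => rw [Function.iterate_succ_apply']; exact hnQ _ ih
  let W : H → Cycle (H × H) := fun x => (Function.periodicOrbit n x).map fun z => (F.opp z, n z)
  have hW : ∀ x ∈ Q, F.IsOrientedCircuit (W x) := fun x hx =>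
    isOrientedCircuit_map_periodicOrbit hnQ
      (fun z hz => inc_eq_of_mem_singleTransitions (hpair.pair_mate_mem (h := F.opp z)
        (by rw [hU]; exact opp_mem_iff.2 hz.1)) (by simp) (by simp [n, hσ]))
      (fun z hz => pair_opp_mem hz.1)
      (fun z hz h => by
        have h2 := h.2
        rw [hg.1, hz.2] at h2
        norm_num at h2) hx (hper x)
  -- `r h` is the half-edge with `g = 1` on the edge of `h`.
  let r : H → H := fun h => if g h = 1 then h else F.opp h
  have hrQ : ∀ h ∈ F.halfEdges, r h ∈ Q := fun h hh => by
    by_cases hgh : g h = 1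
    · simp only [r, if_pos hgh]; exact ⟨hh, hgh⟩
    · simp only [r, if_neg hgh]
      refine ⟨opp_mem_iff.2 hh, ?_⟩
      rw [hg.1, (h1 h hh).resolve_left hgh, neg_neg]
  have hin : ∀ x ∈ Q, ∀ h ∈ F.halfEdges, (∃ s ∈ toCircuit (W x), h ∈ s) ↔
      r h ∈ Function.periodicOrbit n x := by
    intro x hx h hh
    rw [exists_mem_toCircuit]
    constructor
    · rintro ⟨p, hp, hph⟩
      obtain ⟨z, hz, rfl⟩ := Cycle.mem_map.1 hp
      obtain ⟨k, rfl⟩ := (Function.mem_periodicOrbit_iff (hper x)).1 hz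
      have hzQ := hiter x hx k
      rcases hph with h2 | h2
      · have hgh : g h ≠ 1 := by
          rw [h2]
          simp only [hg.1, hzQ.2]
          norm_num
        have : r h = n^[k] x := by rw [show r h = F.opp h from if_neg hgh, h2, opp_opp]
        rw [this]; exact hz
      · have hgh : g h = 1 := h2 ▸ (hnQ _ hzQ).2
        have : r h = n^[k + 1] x := by
          rw [show r h = h from if_pos hgh, h2, Function.iterate_succ_apply']
        rw [this, Function.mem_periodicOrbit_iff (hper x)]
        exact ⟨_, rfl⟩
    · intro hr
      by_cases hgh : g h = 1
      · simp only [r, if_pos hgh] at hr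
        obtain ⟨N, hN, hp⟩ := hper h
        obtain ⟨k, hk⟩ := (Function.mem_periodicOrbit_iff (hper x)).1 hr
        -- The predecessor of `h` on its orbit is `n^[N - 1] h`, where `N` is a period.
        refine ⟨_, Cycle.mem_map.2 ⟨n^[N - 1] h, ?_, rfl⟩, Or.inr ?_⟩
        · rw [Function.mem_periodicOrbit_iff (hper x), ← hk]
          exact ⟨N - 1 + k, Function.iterate_add_apply _ _ _ _⟩
        · change h = n (n^[N - 1] h)
          rw [← Function.iterate_succ_apply' n, show (N - 1).succ = N by omega]
          exact hp.symm
      · simp only [r, if_neg hgh] at hr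
        exact ⟨_, Cycle.mem_map.2 ⟨_, hr, rfl⟩, Or.inl (F.opp_opp h).symm⟩
  have heq : ∀ x, ∀ y ∈ Function.periodicOrbit n x, W y = W x := fun x y hy => by
    obtain ⟨k, rfl⟩ := (Function.mem_periodicOrbit_iff (hper x)).1 hy
    simp only [W, Function.periodicOrbit_apply_iterate_eq (hper x)]
  let P : Finset (Finset (Finset H)) :=
    (Finset.univ.filter fun x => x ∈ Q).image fun x => toCircuit (W x)
  have hmemP : ∀ {C}, C ∈ P ↔ ∃ x ∈ Q, toCircuit (W x) = C := fun {C} => by simp [P]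
  have hpairW : ∀ x ∈ Q, ∀ s ∈ toCircuit (W x), s ∈ singleTransitions T := by
    intro x hx s hs
    obtain ⟨p, hp, rfl⟩ := mem_toCircuit.1 hs
    obtain ⟨z, hz, rfl⟩ := Cycle.mem_map.1 hp
    obtain ⟨k, rfl⟩ := (Function.mem_periodicOrbit_iff (hper x)).1 hz
    exact hpair.pair_mate_mem (by rw [hU]; exact opp_mem_iff.2 (hiter x hx k).1)
  have hTP : ∀ s ∈ singleTransitions T, ∃ C ∈ P, s ∈ C := by
    intro s hs
    obtain ⟨b, hb⟩ : s.Nonempty := by rw [← Finset.card_pos, hpair.card s hs]; norm_num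
    have hbF : b ∈ F.halfEdges := hU ▸ Finset.mem_biUnion.2 ⟨s, hs, hb⟩
    -- If `g b = -1`, a circuit arrives by `b`: the pair that it has at `z = F.opp b` is `(b, σ b)`.
    have key : ∀ b ∈ s, g b = -1 → b ∈ F.halfEdges → ∃ C ∈ P, s ∈ C := by
      intro b hb hgb hbF
      have hz : F.opp b ∈ Q := ⟨opp_mem_iff.2 hbF, by rw [hg.1, hgb, neg_neg]⟩
      refine ⟨_, hmemP.2 ⟨_, hz, rfl⟩, mem_toCircuit.2 ⟨_, Cycle.mem_map.2
        ⟨_, Function.self_mem_periodicOrbit (hper _), rfl⟩, ?_⟩⟩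
      simp only [n, opp_opp]
      exact (hpair.eq_pair_mate hs hb).symm
    rcases h1 b hbF with h | h
    · refine key (σ b) ?_ (by rw [hg.2, h]) ((hσF b).2 hbF)
      rw [hpair.eq_pair_mate hs hb]
      simp [hσ]
    · exact key b hb h hbF
  refine ⟨P, ⟨fun C hC => ?_, fun h hh => ?_⟩, ?_⟩
  · obtain ⟨x, hx, rfl⟩ := hmemP.1 hC
    exact ⟨_, hW x hx, rfl⟩
  · refine ⟨_, ⟨hmemP.2 ⟨r h, hrQ h hh, rfl⟩, (hin _ (hrQ h hh) h hh).2
      (Function.self_mem_periodicOrbit (hper _))⟩, ?_⟩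
    rintro C ⟨hC, hhC⟩
    obtain ⟨x, hx, rfl⟩ := hmemP.1 hC
    rw [heq x _ ((hin x hx h hh).1 hhC)]
  · ext t
    constructor
    · intro ht
      obtain ⟨v, hv⟩ := t.2
      obtain ⟨t', ⟨ht'T, hv'⟩, -⟩ := isTransversal_iff.1 hT v
      obtain ⟨s, hs⟩ := hv.nonempty hF
      have hst' : s ∈ t'.1 := by
        obtain ⟨C, hC, hsC⟩ := ht s hs
        obtain ⟨x, hx, rfl⟩ := hmemP.1 hC
        obtain ⟨t'', ht'', hst''⟩ := mem_singleTransitions.1 (hpairW x hx s hsC)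
        obtain ⟨v'', hv''⟩ := t''.2
        obtain ⟨b, hb⟩ : s.Nonempty := by rw [← Finset.card_pos, hv.1 s hs]; norm_num
        have hvv : v'' = v := (mem_star.1 (hv''.subset_star hst'' hb)).2.symm.trans
          (mem_star.1 (hv.subset_star hs hb)).2
        subst hvv
        rwa [(isTransversal_iff.1 hT v'').unique ⟨ht'T, hv'⟩ ⟨ht'', hv''⟩]
      have : t = t' := Subtype.ext ((hv.eq_pair hF hs).trans (hv'.eq_pair hF hst').symm)
      rwa [this]
    · exact fun ht s hs => hTP s (mem_singleTransitions.2 ⟨t, ht, hs⟩)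

end HalfEdgeGraph

namespace HalfEdgeGraph

variable {V H : Type*} [DecidableEq H] {F : HalfEdgeGraph V H} [DecidableEq V]

/-! ### Total transversal unimodularity -/

section

variable {E : Finset (Finset H)} {B : Type*} {w : B → H → ℚ} {a : B → H}
  {T : Set F.Transition} {k : ℕ} {f : Fin k → B} {g : Fin k → T}

open Classical in
/-- The vertex of a half-edge in the graph obtained by splitting vertices according to the
single transitions `s l`. -/
noncomputable def splitVertex (F : HalfEdgeGraph V H) {ι : Type*} (s : ι → Finset H) (h : H) :
    V × Bool := (F.inc h, decide (∃ l, h ∈ s l))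

theorem sum_splitVertex [Fintype H] {ι : Type*} (s : ι → Finset H) (x : H → ℚ) (Z : Finset H)
    (hZ : ∀ h, h ∉ Z → x h = 0) (v : V) :
    ∑ h with F.inc h = v, x h = ∑ h ∈ Z with F.splitVertex s h = (v, true), x h +
      ∑ h ∈ Z with F.splitVertex s h = (v, false), x h := by
  classical
  rw [← Finset.sum_union]
  · symm
    refine Finset.sum_subset (fun h hh => ?_) fun h hh hn => hZ h fun hhZ => hn ?_
    · simp only [Finset.mem_union, Finset.mem_filter, splitVertex, Prod.mk.injEq] at hh
      simp only [Finset.mem_filter, Finset.mem_univ, true_and]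
      rcases hh with hh | hh <;> exact hh.2.1
    · have hv := (Finset.mem_filter.1 hh).2
      by_cases hl : ∃ l, h ∈ s l
      · simp [splitVertex, hhZ, hv, hl]
      · simp [splitVertex, hhZ, hv, not_exists.1 hl]
  · rw [Finset.disjoint_left]
    intro h h1 h2
    have h3 := (Finset.mem_filter.1 h1).2
    rw [(Finset.mem_filter.1 h2).2] at h3
    simp at h3

/-- A transversal has only one transition at `v`, so no other `o (g l')` meets `v`. Thus `(v, true)`
carries the selected single transition and `(v, false)` the remaining half-edges at `v`. -/
theorem splitVertex_eq_true_iff (hT : IsTransversal F.skewClasses T)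
    (o : F.TransitionalOrientation) (hg : Function.Injective g) {v : V} {l : Fin k}
    (hv : F.IsTransitionAt v (g l).1.1) (h : H) :
    F.splitVertex (fun l => o.1 (g l).1) h = (v, true) ↔ h ∈ o.1 (g l).1 := by
  simp only [splitVertex, Prod.mk.injEq, decide_eq_true_eq]
  constructor
  · rintro ⟨hhv, l', hl'⟩
    obtain ⟨v', hv'⟩ := (g l').1.2
    have hvv : v' = v := (mem_star.1 (hv'.subset_star (o.2 _) hl')).2.symm.trans hhv
    subst hvv
    have := (isTransversal_iff.1 hT v').unique ⟨(g l).2, hv⟩ ⟨(g l').2, hv'⟩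
    rwa [hg (Subtype.ext this)]
  · exact fun hh => ⟨(mem_star.1 (hv.subset_star (o.2 _) hh)).2, l, hh⟩

/-- Let `x` be the flow with coefficients `c` on the rows `f`. If `x` is not integral, its
nonintegral half-edges form a subgraph of the split graph without vertices of degree one. Such a
subgraph carries a nonzero flow `f'`, which again involves only the rows `f` and vanishes through
every `s l`, contradicting `det N ≠ 0`. -/
theorem IsFlowBasis.coeff_integral [Fintype H] [Fintype B] (hw : F.IsFlowBasis E w a)
    (hT : IsTransversal F.skewClasses T) (o : F.TransitionalOrientation)
    (hf : Function.Injective f) (hg : Function.Injective g) (N : Matrix (Fin k) (Fin k) ℚ)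
    (hN : ∀ i l, N i l = ∑ h ∈ o.1 (g l).1, w (f i) h) (hdet : N.det ≠ 0) (c : Fin k → ℚ)
    (hc : ∀ l, ∃ z : ℤ, ∑ i, c i * N i l = z) (i : Fin k) : ∃ z : ℤ, c i = z := by
  classical
  set s : Fin k → Finset H := fun l => o.1 (g l).1 with hs
  let x : H → ℚ := fun h => ∑ i, c i * w (f i) h
  let I : AddSubgroup ℚ := (Int.castAddHom ℚ).range
  have hI : ∀ {y : ℚ}, y ∈ I ↔ ∃ z : ℤ, y = z := fun {y} =>
    ⟨fun ⟨z, hz⟩ => ⟨z, hz.symm⟩, fun ⟨z, hz⟩ => ⟨z, hz.symm⟩⟩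
  have hxF : x ∈ F.flows E := by
    have : x = ∑ i, c i • w (f i) := by ext h; simp [x]
    rw [this]
    exact Submodule.sum_mem _ fun i _ => Submodule.smul_mem _ _ (hw.mem (f i))
  have hxa : ∀ i, x (a (f i)) = c i := fun i => by
    change ∑ j, c j * w (f j) (a (f i)) = c i
    rw [Finset.sum_eq_single i, hw.self, mul_one]
    · exact fun j _ hj => by rw [hw.ne _ _ (fun h => hj (hf h)), mul_zero]
    · simp
  have hxa0 : ∀ b, b ∉ Set.range f → x (a b) = 0 := fun b hb =>
    Finset.sum_eq_zero fun j _ => by rw [hw.ne _ _ (fun h => hb ⟨j, h⟩), mul_zero]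
  have hxs : ∀ l, ∑ h ∈ s l, x h ∈ I := fun l => by
    obtain ⟨z, hz⟩ := hc l
    refine hI.2 ⟨z, ?_⟩
    rw [← hz, Finset.sum_comm]
    exact Finset.sum_congr rfl fun j _ => by rw [hN, Finset.mul_sum]
  suffices h : ∀ h, x h ∈ I by
    rw [← hxa i]
    exact hI.1 (h _)
  by_contra! hcon
  obtain ⟨h₀, hh₀⟩ := hcon
  let Z : Finset H := Finset.univ.filter fun h => x h ∉ I
  have hZ : ∀ h, h ∈ Z ↔ x h ∉ I := fun h => by simp [Z]
  have hZF : Z ⊆ F.halfEdges := fun h hh => by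
    by_contra hn
    exact (hZ h).1 hh (eq_zero_of_skew hxF.1 hn ▸ I.zero_mem)
  have hZopp : ∀ h ∈ Z, F.opp h ∈ Z := fun h hh => by
    rw [hZ] at hh ⊢
    rwa [hxF.1, neg_mem_iff]
  -- On the side `(v, true)` this is the hypothesis on `c N`, or an empty sum; on `(v, false)` it
  -- follows from conservation at `v`.
  have hfib : ∀ y, ∑ h with F.splitVertex s h = y, x h ∈ I := by
    have htrue : ∀ v, ∑ h with F.splitVertex s h = (v, true), x h ∈ I := by
      intro v
      by_cases hv : ∃ l, F.IsTransitionAt v (g l).1.1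
      · obtain ⟨l, hl⟩ := hv
        simp only [hs, splitVertex_eq_true_iff hT o hg hl]
        simpa using hxs l
      · rw [Finset.filter_eq_empty_iff.2, Finset.sum_empty]
        · exact I.zero_mem
        · intro h _ hh
          simp only [splitVertex, Prod.mk.injEq, decide_eq_true_eq] at hh
          obtain ⟨rfl, l, hl⟩ := hh
          obtain ⟨v', hv'⟩ := (g l).1.2
          rw [(mem_star.1 (hv'.subset_star (o.2 _) hl)).2] at hv
          exact hv ⟨l, hv'⟩
    rintro ⟨v, b⟩
    cases b with
    | true => exact htrue v
    | false =>
      have h1 := sum_splitVertex (F := F) s x Finset.univ (by simp) v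
      rw [hxF.2.1] at h1
      have h2 := I.neg_mem (htrue v)
      rwa [← eq_neg_of_add_eq_zero_right h1.symm] at h2
  obtain ⟨f', hf'0, hf'Z, hf'1, hf'2⟩ := exists_ne_zero_fiber_sum_eq_zero Z ⟨h₀, (hZ _).2 hh₀⟩
    (fun h => ({h, F.opp h} : Finset H)) (F.splitVertex s)
    (fun h hh => ⟨F.opp h, hZopp h hh, F.isPairing_edges.mate_ne (hZF hh), by
      rw [opp_opp, Finset.pair_comm]⟩)
    -- An integral fibre sum cannot have exactly one nonintegral term.
    (fun h hh => by
      by_contra! hcon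
      have h1 := hfib (F.splitVertex s h)
      rw [← Finset.add_sum_erase _ _
        (show h ∈ Finset.univ.filter _ by simp)] at h1
      refine (hZ h).1 hh ((AddSubgroup.add_mem_cancel_right _ (I.sum_mem fun h' hh' => ?_)).1 h1)
      obtain ⟨hne, hmem⟩ := Finset.mem_erase.1 hh'
      by_contra hn
      exact hcon h' ((hZ _).2 hn) hne (Finset.mem_filter.1 hmem).2)
  have hskew := F.isPairing_edges.apply_mate_eq_neg hZF hZopp hf'Z hf'1
  have hf'F : f' ∈ F.flows E := by
    refine ⟨hskew, fun v => ?_, fun e he h hh => hf'Z h fun hhZ => (hZ h).1 hhZ ?_⟩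
    · rw [sum_splitVertex (F := F) s f' Z hf'Z v, hf'2, hf'2, add_zero]
    · rw [hxF.2.2 e he h hh]
      exact I.zero_mem
  have hf's : ∀ l, ∑ h ∈ s l, f' h = 0 := fun l => by
    obtain ⟨v, hv⟩ := (g l).1.2
    rw [← hf'2 (v, true)]
    simp only [hs, splitVertex_eq_true_iff hT o hg hv]
    symm
    refine Finset.sum_subset (fun h hh => (Finset.mem_filter.1 hh).2) fun h hh hn => hf'Z h ?_
    exact fun hhZ => hn (Finset.mem_filter.2 ⟨hhZ, hh⟩)
  -- At the coordinates outside the chosen rows `x` is zero, hence integral, so the support of `f'`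
  -- avoids them.
  have hout : ∀ b, b ∉ Set.range f → f' (a b) = 0 := fun b hb => hf'Z _ fun hm =>
    (hZ _).1 hm (hxa0 b hb ▸ I.zero_mem)
  have hexp : ∀ h, f' h = ∑ i, f' (a (f i)) * w (f i) h := fun h => by
    rw [hw.eq_sum hf'F h]
    exact (Fintype.sum_of_injective f hf _ _
      (fun b hb => by rw [hout b hb, zero_mul]) fun _ => rfl).symm
  have hvec : Matrix.vecMul (fun i => f' (a (f i))) N = 0 := by
    ext l
    change ∑ i, f' (a (f i)) * N i l = 0
    rw [← hf's l, Finset.sum_congr rfl fun h _ => hexp h, Finset.sum_comm]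
    exact Finset.sum_congr rfl fun j _ => by rw [hN, Finset.mul_sum]
  have hzero := Matrix.eq_zero_of_vecMul_eq_zero hdet hvec
  apply hf'0
  refine hw.ext f' hf'F fun b => ?_
  by_cases hb : b ∈ Set.range f
  · obtain ⟨i, rfl⟩ := hb
    exact congrFun hzero i
  · exact hout b hb

/-- For a nonsingular square submatrix `N`, every row of the inverse multiplied by `N` is a row of
the identity, so `coeff_integral` makes the inverse integral. As `N` is integral too, its
determinant is `±1`. -/
theorem IsFlowBasis.isTotallyTransversallyUnimodular [Fintype H] [Fintype B]
    (hw : F.IsFlowBasis E w a) (o : F.TransitionalOrientation) (A : Matrix B F.Transition ℚ)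
    (hA : ∀ b t, A b t = ∑ h ∈ o.1 t, w b h) :
    IsTotallyTransversallyUnimodular F.skewClasses A := by
  intro T hT k f g hf hg
  rw [Matrix.submatrix_submatrix]
  set N := A.submatrix (id ∘ f) (Subtype.val ∘ g) with hN
  by_cases hdet : N.det = 0
  · exact ⟨0, by simp [hdet]⟩
  have hNa : ∀ i l, N i l = ∑ h ∈ o.1 (g l).1, w (f i) h := fun i l => hA _ _
  choose z hz using hw.int
  have hNint : N = (Matrix.of fun i l => ∑ h ∈ o.1 (g l).1, z (f i) h).map (Int.cast : ℤ → ℚ) := by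
    ext i l
    rw [hNa]
    simp [hz]
  have hinv : N⁻¹ * N = 1 := Matrix.nonsing_inv_mul _ (isUnit_iff_ne_zero.2 hdet)
  have hint : ∀ j i, ∃ y : ℤ, N⁻¹ j i = y := fun j i =>
    hw.coeff_integral hT o hf hg N hNa hdet (N⁻¹ j) (fun l => by
      have h1 : ∑ i, N⁻¹ j i * N i l = (1 : Matrix (Fin k) (Fin k) ℚ) j l := by
        rw [← hinv, Matrix.mul_apply]
      rw [h1, Matrix.one_apply]
      split_ifs
      · exact ⟨1, by simp⟩
      · exact ⟨0, by simp⟩) i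
  choose y hy using hint
  have hN' : N⁻¹ = (Matrix.of y).map (Int.cast : ℤ → ℚ) := by
    ext j i
    exact hy j i
  rw [hN', hNint] at hinv
  rw [hNint]
  exact Matrix.det_mem_range_signType_cast _ _ hinv

end

end HalfEdgeGraph

/-! ### Multimatroids -/

section Multimatroid

variable {U : Type*} {Ω : Set (Set U)}

theorem IsTransversal.eq_of_subset (hΩ : Setoid.IsPartition Ω) {S T : Set U}
    (hT : IsTransversal Ω T) (hST : S ⊆ T) (hS : ∀ ω ∈ Ω, ¬ Disjoint ω S) : S = T := by
  refine hST.antisymm fun x hx => ?_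
  obtain ⟨ω, ⟨hω, hxω⟩, -⟩ := hΩ.2 x
  obtain ⟨s, hsω, hsS⟩ := Set.not_disjoint_iff.1 (hS ω hω)
  rwa [(hT ω hω).unique ⟨hx, hxω⟩ ⟨hST hsS, hsω⟩]

theorem IsTransversal.replace (hΩ : Setoid.IsPartition Ω) {T ω : Set U}
    (hT : IsTransversal Ω T) (hω : ω ∈ Ω) {x : U} (hx : x ∈ ω) :
    IsTransversal Ω (T \ ω ∪ {x}) := by
  intro ω' hω'
  by_cases h : ω' = ω
  · subst h
    refine ⟨x, ⟨Or.inr rfl, hx⟩, ?_⟩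
    rintro y ⟨hy | hy, hyω⟩
    · exact absurd hyω hy.2
    · exact hy
  · have hdis : ∀ y ∈ ω', y ∉ ω := fun y hy hy' =>
      h ((hΩ.2 y).unique ⟨hω', hy⟩ ⟨hω, hy'⟩)
    obtain ⟨t, ⟨htT, htω⟩, hu⟩ := hT ω' hω'
    refine ⟨t, ⟨Or.inl ⟨htT, hdis t htω⟩, htω⟩, ?_⟩
    rintro y ⟨hy | hy, hyω⟩
    · exact hu y ⟨hy.1, hyω⟩
    · rw [Set.mem_singleton_iff.1 hy] at hyω
      exact absurd hx (hdis x hyω)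

namespace Multimatroid

theorem r_le_add_ncard (Q : Multimatroid Ω) (S S' : Subtransversal Ω) (h : S.1 ⊆ S'.1) :
    Q.r S' ≤ Q.r S + (S'.1 \ S.1).ncard := by
  have := Q.finite
  obtain ⟨M, -, hr⟩ := Q.matroid S'
  have h1 := (M.eRk_le_eRk_add_eRk_sdiff h).trans
    (add_le_add_right (M.eRk_le_encard (S'.1 \ S.1)) _)
  rw [hr S h, hr S' subset_rfl, ← (Set.toFinite (S'.1 \ S.1)).cast_ncard_eq] at h1
  exact_mod_cast h1

/-- Every subtransversal extends to a transversal with independent new elements. -/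
theorem exists_transversal (Q : Multimatroid Ω) {k : ℕ} (hk : 2 ≤ k) (hQ : Q.IsKMatroid k)
    (S : Subtransversal Ω) : ∃ T : Subtransversal Ω, IsTransversal Ω T.1 ∧ S.1 ⊆ T.1 ∧
      Q.r T = Q.r S + (T.1 \ S.1).ncard := by
  have := Q.finite
  induction hn : (S.1ᶜ).ncard using Nat.strong_induction_on generalizing S with
  | _ n ih =>
    obtain ⟨T₀, hT₀, hST₀⟩ := S.2
    by_cases hS : ∀ ω ∈ Ω, ¬ Disjoint ω S.1
    · have h := hT₀.eq_of_subset Q.isPartition hST₀ hS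
      exact ⟨S, h ▸ hT₀, subset_rfl, by simp⟩
    push Not at hS
    obtain ⟨ω, hω, hdis⟩ := hS
    have hcard : 1 < ω.ncard := by rw [hQ ω hω]; omega
    obtain ⟨x, hx, y, hy, hxy⟩ := (Set.one_lt_ncard (Set.toFinite ω)).1 hcard
    have hsub : ∀ z ∈ ω, ∃ T, IsTransversal Ω T ∧ S.1 ∪ {z} ⊆ T := fun z hz =>
      ⟨_, hT₀.replace Q.isPartition hω hz, Set.union_subset_union_left _ fun u hu =>
        ⟨hST₀ hu, fun huω => Set.disjoint_left.1 hdis huω hu⟩⟩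
    -- Of two elements in a class missed by `S`, one raises the rank, and it does so by exactly one.
    -- Adding it shrinks the complement of `S`, on whose size the induction runs.
    have key : ∀ z, ∀ hz : z ∈ ω, Q.r S < Q.r ⟨_, hsub z hz⟩ → ∃ T : Subtransversal Ω,
        IsTransversal Ω T.1 ∧ S.1 ⊆ T.1 ∧ Q.r T = Q.r S + (T.1 \ S.1).ncard := by
      intro z hz hlt
      have hzS : z ∉ S.1 := Set.disjoint_left.1 hdis hz
      have hle := Q.r_le_add_ncard S ⟨_, hsub z hz⟩ Set.subset_union_left
      have h1 : ((S.1 ∪ {z}) \ S.1).ncard = 1 := by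
        rw [Set.union_sdiff_left, sdiff_eq_left.2 (Set.disjoint_singleton_left.2 hzS), Set.ncard_singleton]
      rw [h1] at hle
      obtain ⟨T, hT, hsT, hr⟩ := ih _ (by
        rw [← hn]
        refine Set.ncard_lt_ncard ⟨Set.compl_subset_compl.2 Set.subset_union_left, fun h => ?_⟩
          (Set.toFinite _)
        exact h hzS (Or.inr rfl)) ⟨_, hsub z hz⟩ rfl
      refine ⟨T, hT, Set.subset_union_left.trans hsT, ?_⟩
      have hzT : z ∈ T.1 \ S.1 := ⟨hsT (Or.inr rfl), hzS⟩
      have h2 : T.1 \ (S.1 ∪ {z}) = (T.1 \ S.1) \ {z} := by rw [Set.sdiff_sdiff]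
      have h3 := Set.ncard_sdiff_singleton_add_one hzT (Set.toFinite _)
      rw [h2] at hr
      omega
    rcases lt_max_iff.1 (Q.lt_max S ω hω hdis x hx y hy hxy ⟨_, hsub x hx⟩ ⟨_, hsub y hy⟩ rfl rfl)
      with h | h
    · exact key x hx h
    · exact key y hy h

/-- A `k`-matroid with `k ≥ 2` is determined by the ranks of its transversals. -/
theorem eq_of_forall_transversal {Q Q' : Multimatroid Ω} {k : ℕ} (hk : 2 ≤ k)
    (hQ : Q.IsKMatroid k) (h : ∀ T : Subtransversal Ω, IsTransversal Ω T.1 → Q.r T = Q'.r T) :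
    Q = Q' := by
  -- Take `T` from `exists_transversal` for `Q`; then `Q.r S` equals `Q'.r T` minus the number of
  -- new elements, which is at most `Q'.r S`.
  have hle : ∀ {Q Q' : Multimatroid Ω}, Q.IsKMatroid k →
      (∀ T : Subtransversal Ω, IsTransversal Ω T.1 → Q.r T = Q'.r T) → ∀ S, Q.r S ≤ Q'.r S := by
    intro Q Q' hQ h S
    obtain ⟨T, hT, hST, hr⟩ := Q.exists_transversal hk hQ S
    have := Q'.r_le_add_ncard S T hST
    rw [← h T hT] at this
    omega
  have hr : Q.r = Q'.r := funext fun S =>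
    (hle hQ h S).antisymm (hle (Q := Q') hQ (fun T hT => (h T hT).symm) S)
  cases Q
  cases Q'
  simp only at hr
  subst hr
  rfl

end Multimatroid

end Multimatroid

/-! ### The Eulerian 3-matroid and its representation -/

namespace HalfEdgeGraph

variable {V H : Type*} [DecidableEq H] {F : HalfEdgeGraph V H}

section

variable [DecidableEq V]

theorem isPartition_skewClasses (hF : F.IsRegular 4) : Setoid.IsPartition F.skewClasses := by
  constructor
  · rintro ⟨v, hv⟩
    obtain ⟨t, ht⟩ := exists_transitionAt hF v
    have : t ∈ (∅ : Set F.Transition) := hv ▸ ht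
    exact this
  · intro t
    obtain ⟨v, hv⟩ := t.2
    refine ⟨_, ⟨⟨v, rfl⟩, hv⟩, ?_⟩
    rintro _ ⟨⟨v', rfl⟩, hv'⟩
    have hv' : F.IsTransitionAt v' t.1 := hv'
    rw [hv.vertex_unique hF hv']

theorem IsEulerian3Matroid.unique [Fintype V] [Fintype H] (hF : F.IsRegular 4)
    {Q Q' : Multimatroid F.skewClasses} (hQ : F.IsEulerian3Matroid Q)
    (hQ' : F.IsEulerian3Matroid Q') : Q' = Q := by
  refine Multimatroid.eq_of_forall_transversal (k := 3) (by norm_num) hQ'.1 fun T hT => ?_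
  obtain ⟨P, hP, hPT⟩ := exists_isCircuitPartition hF hT
  have h1 := hQ.2 T hT P hP hPT
  have h2 := hQ'.2 T hT P hP hPT
  rw [← h1] at h2
  exact_mod_cast h2

theorem card_le_ncard_transversal [Fintype V] [Finite H] (hF : F.IsRegular 4)
    {T : Set F.Transition} (hT : IsTransversal F.skewClasses T) : Fintype.card V ≤ T.ncard := by
  choose t ht hu using isTransversal_iff.1 hT
  rw [← Nat.card_eq_fintype_card, ← Nat.card_coe_set_eq]
  refine Nat.card_le_card_of_injective (fun v => (⟨t v, (ht v).1⟩ : T)) fun v v' h => ?_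
  have h' : t v = t v' := congrArg Subtype.val h
  exact (ht v).2.vertex_unique hF (h' ▸ (ht v').2)

/-- Define `r` by column rank. By `finrank_span`, the inequality axiom and the rank formula turn
into statements on `splitFlows`. For strictness, extending `∅` yields a transversal whose rank is
its size, hence at least `|V|`, while `A` has only `|V|` rows. -/
theorem IsFlowBasis.exists_isEulerian3Matroid [Fintype V] [Fintype H] (hF : F.IsRegular 4)
    {E : Finset (Finset H)} (hE : F.OneEdgePerComponent E) {B : Type*} [Fintype B]
    {w : B → H → ℚ} {a : B → H} (hw : F.IsFlowBasis E w a) (o : F.TransitionalOrientation)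
    (A : Matrix B F.Transition ℚ) (hA : ∀ b t, A b t = ∑ h ∈ o.1 t, w b h) :
    ∃ Q : Multimatroid F.skewClasses, F.IsEulerian3Matroid Q ∧ IsStrictRepresentation A Q := by
  have hcard : Fintype.card B = Fintype.card V := by
    rw [← finrank_flows hF hE, ← hw.equiv.finrank_eq, Module.finrank_fintype_fun_eq_card]
  have hrank := hw.finrank_span hF o A hA
  rw [hcard] at hrank
  let Q : Multimatroid F.skewClasses :=
    { finite := inferInstance
      isPartition := isPartition_skewClasses hF
      r := fun S => Module.finrank ℚ (Submodule.span ℚ (A.col '' S.1))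
      matroid := fun S => ⟨(vectorMatroid ℚ A.col).restrict S.1, rfl, fun R hR => by
        rw [Matroid.restrict_eRk_eq _ hR, vectorMatroid_eRk]⟩
      lt_max := by
        rintro S _ ⟨v, rfl⟩ hdis x hx y hy hxy Sx Sy hSx hSy
        obtain ⟨T, hT, hST⟩ := S.2
        obtain ⟨f, hf, hxy⟩ := hE.exists_mem_splitFlows hF hT hST
          (fun t ht htv => Set.disjoint_left.1 hdis htv ht) hx hy hxy
        have key : ∀ (z : F.Transition) (S' : Set F.Transition), S' = S.1 ∪ {z} →
            (¬ ∀ s ∈ z.1, ∑ h ∈ s, f h = 0) →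
            Module.finrank ℚ (Submodule.span ℚ (A.col '' S.1)) <
              Module.finrank ℚ (Submodule.span ℚ (A.col '' S')) := by
          intro z S' hS' hz
          have hlt : F.splitFlows E S' < F.splitFlows E S.1 := by
            refine ⟨fun f' hf' => ⟨hf'.1, fun t ht => hf'.2 t (hS' ▸ Or.inl ht)⟩, fun hle => ?_⟩
            exact hz ((hle hf).2 z (hS' ▸ Or.inr rfl))
          have h1 := Submodule.finrank_lt_finrank_of_lt hlt
          have h2 := hrank S.1
          have h3 := hrank S'
          omega
        rw [lt_max_iff]
        rcases hxy with h | h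
        · exact Or.inl (key x _ hSx h)
        · exact Or.inr (key y _ hSy h) }
  have hQ3 : Q.IsKMatroid 3 := by
    rintro _ ⟨v, rfl⟩
    exact ncard_transitions hF v
  refine ⟨Q, ⟨hQ3, fun T hT P hP hPT => ?_⟩, vectorMatroid ℚ A.col,
    ⟨vectorMatroid_ground _, fun I => vectorMatroid_indep _⟩,
    ⟨vectorMatroid_ground _, fun S => vectorMatroid_eRk _ _⟩, ?_, ?_⟩
  · have h1 := hrank T.1
    have h2 := hP.finrank_splitFlows hT hPT hE
    change ((Module.finrank ℚ (Submodule.span ℚ (A.col '' T.1)) : ℕ) : ℤ) = _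
    omega
  · obtain ⟨T₀, hT₀⟩ := exists_isTransversal hF
    obtain ⟨T, hT, -, hr⟩ := Q.exists_transversal (by norm_num) hQ3
      ⟨∅, T₀, hT₀, Set.empty_subset _⟩
    refine ⟨T, ?_⟩
    have h1 := card_le_ncard_transversal hF hT
    have h2 : Fintype.card V ≤ Q.r T := by
      rw [hr]
      simp only [Set.sdiff_empty]
      omega
    have h3 : (vectorMatroid ℚ A.col).eRank ≤ (Fintype.card V : ℕ∞) := by
      rw [Matroid.eRank_def, vectorMatroid_eRk, Nat.cast_le, ← hcard,
        ← Module.finrank_fintype_fun_eq_card ℚ]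
      exact Submodule.finrank_le _
    have h4 : (Q.r T : ℕ∞) ≤ (vectorMatroid ℚ A.col).eRank :=
      (vectorMatroid_eRk A.col T.1).symm.trans_le (Matroid.eRk_le_eRank _ _)
    exact h4.antisymm (h3.trans (by exact_mod_cast h2))
  · rintro _ ⟨S, rfl⟩
    exact (vectorMatroid_eRk A.col S.1).symm.trans_le (Matroid.eRk_le_eRank _ _)

theorem exists_representation [Fintype V] [Fintype H] (hF : F.IsRegular 4)
    {E : Finset (Finset H)} {B : Finset (Cycle (H × H))} (D : F.DirectedVersion)
    (o : F.TransitionalOrientation) (hE : F.OneEdgePerComponent E)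
    (hB : (F.deleteEdges E).IsStrictlyFundamentalCycleBasis B) :
    ∃ Q : Multimatroid F.skewClasses, F.IsEulerian3Matroid Q ∧
      IsStrictRepresentation (F.representationMatrix B D o) Q ∧
      IsTotallyTransversallyUnimodular F.skewClasses (F.representationMatrix B D o) := by
  obtain ⟨a, hw⟩ := hB.exists_isFlowBasis hE.1
  have hA := representationMatrix_apply B D o
  obtain ⟨Q, hQ, hrep⟩ := hw.exists_isEulerian3Matroid hF hE o _ hA
  exact ⟨Q, hQ, hrep, hw.isTotallyTransversallyUnimodular o _ hA⟩

theorem exists_oneEdgePerComponent [Finite V] (hF : F.IsRegular 4) :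
    ∃ E, F.OneEdgePerComponent E := by
  classical
  have : Finite F.Component := Quot.finite F.Adj
  have := Fintype.ofFinite F.Component
  have hex : ∀ c : F.Component, ∃ h ∈ F.halfEdges, F.comp h = c := by
    rintro ⟨v⟩
    obtain ⟨h, hh⟩ := star_nonempty hF v
    exact ⟨h, (mem_star.1 hh).1, congrArg (Quot.mk F.Adj) (mem_star.1 hh).2⟩
  choose h hh hc using hex
  refine ⟨Finset.univ.image fun c => {h c, F.opp (h c)}, fun e he => ?_, fun c => ?_⟩
  · obtain ⟨c, -, rfl⟩ := Finset.mem_image.1 he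
    exact pair_opp_mem (hh c)
  · refine ⟨{h c, F.opp (h c)}, ⟨Finset.mem_image_of_mem _ (Finset.mem_univ c), h c, by simp,
      hc c⟩, ?_⟩
    rintro e ⟨he, a, ha, hac⟩
    obtain ⟨c', -, rfl⟩ := Finset.mem_image.1 he
    have hac : F.comp a = c := hac
    have hcc : F.comp a = c' := by
      simp only [Finset.mem_insert, Finset.mem_singleton] at ha
      rcases ha with h1 | h1
      · exact (congrArg F.comp h1).trans (hc c')
      · exact (congrArg F.comp h1).trans ((comp_opp _).trans (hc c'))
    rw [← hcc, hac]

theorem nonempty_transitionalOrientation (hF : F.IsRegular 4) :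
    Nonempty F.TransitionalOrientation := by
  have h : ∀ t : F.Transition, ∃ s, s ∈ t.1 := fun t => by
    obtain ⟨v, hv⟩ := t.2
    exact hv.nonempty hF
  choose o ho using h
  exact ⟨⟨o, ho⟩⟩

end

/-- Adding an edge `e` to a maximal forest creates a circuit inside the enlarged set. This circuit
traverses `e`, since otherwise it would lie in the forest, so it is fundamental for `e`. -/
theorem exists_isStrictlyFundamentalCycleBasis (G : HalfEdgeGraph V H) :
    ∃ B, G.IsStrictlyFundamentalCycleBasis B := by
  classical
  have hempty : G.IsForest ∅ := by
    refine ⟨Finset.empty_subset _, ?_⟩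
    rintro ⟨W, hW, hT⟩
    have hne : W.toMultiset ≠ 0 := fun h => hW.2.1 (Cycle.toMultiset_eq_nil.1 h)
    obtain ⟨p, hp⟩ := Multiset.exists_mem_of_ne_zero hne
    have hp := mem_toMultiset.1 hp
    obtain ⟨e, he, hpe⟩ := Finset.mem_biUnion.1 (hW.1.snd_mem hp)
    exact absurd (hT e he (hW.1.traverses hp (Or.inr rfl) he hpe)) (by simp)
  have hfin : {T | G.IsForest T}.Finite :=
    (Finset.finite_toSet G.edges.powerset).subset fun T hT => by simpa using hT.1
  obtain ⟨T, hT⟩ := hfin.exists_maximal ⟨∅, hempty⟩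
  have hT : Maximal G.IsForest T := hT
  have hex : ∀ e : ↥(G.edges \ T), ∃ W, G.IsFundamentalCircuit T e.1 W := by
    rintro ⟨e, he⟩
    obtain ⟨heG, heT⟩ := Finset.mem_sdiff.1 he
    have hnot : ¬ G.IsForest (insert e T) := fun h =>
      heT (hT.le_of_ge h (Finset.subset_insert e T) (Finset.mem_insert_self e T))
    have hsub : insert e T ⊆ G.edges := Finset.insert_subset heG hT.prop.1
    obtain ⟨W, hW, hWT⟩ := not_not.1 fun h => hnot ⟨hsub, h⟩
    have honly : ∀ e' ∈ G.edges \ T, Traverses W e' → e' = e := fun e' he' htr =>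
      (Finset.mem_insert.1 (hWT e' (Finset.mem_sdiff.1 he').1 htr)).resolve_right
        (Finset.mem_sdiff.1 he').2
    refine ⟨W, hW, fun e' he' => ⟨honly e' he', ?_⟩⟩
    rintro rfl
    by_contra hntr
    refine hT.prop.2 ⟨W, hW, fun e'' he'' htr => ?_⟩
    by_contra hn
    exact hntr (honly e'' (Finset.mem_sdiff.2 ⟨he'', hn⟩) htr ▸ htr)
  choose W hW using hex
  refine ⟨Finset.univ.image W, T, hT, fun C hC => ?_, fun e he => ?_⟩
  · obtain ⟨e, -, rfl⟩ := Finset.mem_image.1 hC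
    exact ⟨e.1, e.2, hW e⟩
  · refine ⟨W ⟨e, he⟩, ⟨Finset.mem_image_of_mem _ (Finset.mem_univ _), hW ⟨e, he⟩⟩, ?_⟩
    rintro C ⟨hC, hCe⟩
    obtain ⟨e', -, rfl⟩ := Finset.mem_image.1 hC
    have : e'.1 = e := (hCe.2 _ e'.2).1 (((hW e').2 _ e'.2).2 rfl)
    congr 1
    exact Subtype.ext this

end HalfEdgeGraph

theorem mainTheorem4 {V H : Type*} [Fintype V] [DecidableEq V] [Fintype H] [DecidableEq H]
    (F : HalfEdgeGraph V H) (hF : F.IsRegular 4) :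
    ∃ Q : Multimatroid F.skewClasses, F.IsEulerian3Matroid Q ∧
      (∀ Q' : Multimatroid F.skewClasses, F.IsEulerian3Matroid Q' → Q' = Q) ∧
      (∃ (E : Finset (Finset H)) (B : Finset (Cycle (H × H))) (D : F.DirectedVersion)
        (o : F.TransitionalOrientation),
        F.OneEdgePerComponent E ∧ (F.deleteEdges E).IsStrictlyFundamentalCycleBasis B ∧
        IsStrictRepresentation (F.representationMatrix B D o) Q ∧
        IsTotallyTransversallyUnimodular F.skewClasses (F.representationMatrix B D o)) ∧
      ∀ (E : Finset (Finset H)) (B : Finset (Cycle (H × H))) (D : F.DirectedVersion)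
        (o : F.TransitionalOrientation),
        F.OneEdgePerComponent E → (F.deleteEdges E).IsStrictlyFundamentalCycleBasis B →
        IsStrictRepresentation (F.representationMatrix B D o) Q ∧
        IsTotallyTransversallyUnimodular F.skewClasses (F.representationMatrix B D o) := by
  obtain ⟨E, hE⟩ := HalfEdgeGraph.exists_oneEdgePerComponent hF
  obtain ⟨B, hB⟩ := (F.deleteEdges E).exists_isStrictlyFundamentalCycleBasis
  obtain ⟨D⟩ := F.nonempty_directedVersion
  obtain ⟨o⟩ := HalfEdgeGraph.nonempty_transitionalOrientation hF
  obtain ⟨Q, hQ, hrep⟩ := HalfEdgeGraph.exists_representation hF D o hE hB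
  refine ⟨Q, hQ, fun Q' hQ' => hQ.unique hF hQ', ⟨E, B, D, o, hE, hB, hrep⟩,
    fun E B D o hE hB => ?_⟩
  obtain ⟨Q', hQ', hrep'⟩ := HalfEdgeGraph.exists_representation hF D o hE hB
  rwa [hQ.unique hF hQ'] at hrep'
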